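/- \textbf{Setting.} Let $k>0$ and $\alpha\in\mathbb R$, put $\alpha_j:=j+\alpha$ and assume $k^2\neq\alpha_j^2$ for all $j\in\mathbb Z$. Let $\beta_j:=(k^2-\alpha_j^2)^{1/2}$, with $\beta_j>0$ if $\alpha_j^2<k^2$ and $\beta_j\in i(0,\infty)$ if $\alpha_j^2>k^2$, and let $$G_{k,\alpha}(x):=\frac{i}{4\pi}\sum_{j\in\mathbb Z}\frac1{\beta_j}\exp(i\alpha_jx_1+i\beta_j|x_2|)$$ be the $\alpha$-quasi-periodic Green's function. Let $D\subset(-\pi,\pi)\times(-\rho,\rho)$ be open, for some $\rho>0$. Denote by $H^1_\alpha(D)$ the space of all $u\in H^1(D)$ of the form $u=U|_D$ with some $U\in H^1_{\rm loc}(\mathbb R^2)$ such that $U(x_1+2\pi,x_2)=e^{2\pi i\alpha}U(x_1,x_2)$. For $g\in L^2(D,\mathbb C^2)$ let $$L_kg:=\operatorname{div}V_kg,\qquad V_kg(x):=\int_DG_{k,\alpha}(x-y)g(y)\,dy,$$ with the divergence in the weak sense in $D$. Let $Q\in L^\infty(D,\mathbb C^{2\times2})$ be such that, for almost every $x\in D$,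 the matrix $\operatorname{Re}Q(x)=\frac12(Q(x)+Q(x)^*)$ is either positive definite or negative definite (which of the two may depend on $x$, and no uniform bound is assumed). Let $H^1_{\alpha,Q}(D)$ be the completion of $H^1_\alpha(D)$ in the norm $$\|u\|^2_{H^1_{\alpha,Q}(D)}:=\big\||\operatorname{Re}Q|^{1/2}\nabla u\big\|^2_{L^2(D,\mathbb C^2)}+\|u\|^2_{L^2(D)}.$$ For $v\in H^1_{\alpha,Q}(D)$ the gradient $\nabla v$ is the measurable field, unique almost everywhere in $D$, for which $|\operatorname{Re}Q|^{1/2}\nabla v$ is the $L^2$-limit of $|\operatorname{Re}Q|^{1/2}\nabla u_n$ whenever $u_n\in H^1_\alpha(D)$ and $u_n\to v$ in $H^1_{\alpha,Q}(D)$. \textbf{Proposition.} The operator $L_k$ is well defined from $L^2(D,\mathbb C^2)$ into $H^1_\alpha(D)$. Let $f\in L^2(D,\mathbb C^2)$ and consider the Lippmann--Schwinger equation $u=L_k(Q\nabla u+f)$. (i) If $u\in H^1_\alpha(D)$ satisfies it in $H^1_\alpha(D)$, then the image of $u$ in $H^1_{\alpha,Q}(D)$ satisfies it in $H^1_{\alpha,Q}(D)$.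 (ii) Conversely, if $v\in H^1_{\alpha,Q}(D)$ satisfies it in $H^1_{\alpha,Q}(D)$ (that is, $Q\nabla v\in L^2(D,\mathbb C^2)$ and $v$ is the image of $L_k(Q\nabla v+f)$), then $v$ is the image of some $u\in H^1_\alpha(D)$ that satisfies it in $H^1_\alpha(D)$. The requirement $Q\nabla v\in L^2(D,\mathbb C^2)$ holds for every $v\in H^1_{\alpha,Q}(D)$ if there is $C>0$ with $|\operatorname{Im}Q(x)\xi|\le C|\operatorname{Re}Q(x)\xi|$ for almost every $x\in D$ and all $\xi\in\mathbb C^2$, where $\operatorname{Im}Q=\frac1{2i}(Q-Q^*)$. -/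

import Mathlib

open MeasureTheory Set
open scoped ContDiff ENNReal

noncomputable section

namespace Grating

/-- The value space `ℂ²` with its Euclidean norm. -/
abbrev C2 : Type := EuclideanSpace ℂ (Fin 2)

/-- `L²(D)`. Points of the plane are pairs `x = (x₁, x₂)`. -/
abbrev L2 (D : Set (ℝ × ℝ)) : Type := Lp ℂ 2 (volume.restrict D)

/-- `L²(D, ℂ²)`. -/
abbrev L2v (D : Set (ℝ × ℝ)) : Type := Lp C2 2 (volume.restrict D)

/-! ### Quasi-periodic Sobolev spaces -/

/-- `φ` is a (real valued) test function with compact support in the open set `D`. -/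
structure IsTest (D : Set (ℝ × ℝ)) (φ : ℝ × ℝ → ℝ) : Prop where
  smooth : ContDiff ℝ ∞ φ
  compact : HasCompactSupport φ
  supp : tsupport φ ⊆ D

/-- `∂φ/∂x₁`. -/
def d1 (φ : ℝ × ℝ → ℝ) (x : ℝ × ℝ) : ℝ := fderiv ℝ φ x (1, 0)

/-- `∂φ/∂x₂`. -/
def d2 (φ : ℝ × ℝ → ℝ) (x : ℝ × ℝ) : ℝ := fderiv ℝ φ x (0, 1)

/-- `f` is square integrable on all compact sets. -/
def IsL2Loc {E : Type*} [NormedAddCommGroup E] (f : ℝ × ℝ → E) : Prop :=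
  ∀ K : Set (ℝ × ℝ), IsCompact K → MemLp f 2 (volume.restrict K)

/-- `U ∈ H¹_loc(ℝ²)` with weak gradient `P`. -/
structure IsH1Loc (U : ℝ × ℝ → ℂ) (P : ℝ × ℝ → C2) : Prop where
  fn : IsL2Loc U
  grad : IsL2Loc P
  weak1 : ∀ φ, IsTest univ φ → ∫ x, d1 φ x • U x = -∫ x, φ x • P x 0
  weak2 : ∀ φ, IsTest univ φ → ∫ x, d2 φ x • U x = -∫ x, φ x • P x 1

/-- `U` is `α`-quasi-periodic in `x₁`:  `U(x₁ + 2π, x₂) = exp(2πiα) U(x₁, x₂)`. -/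
def IsQuasiPeriodic (α : ℝ) (U : ℝ × ℝ → ℂ) : Prop :=
  ∀ᵐ x : ℝ × ℝ, U (x.1 + 2 * Real.pi, x.2) = Complex.exp (2 * Real.pi * Complex.I * α) * U x

theorem IsTest.continuous_d1 {D : Set (ℝ × ℝ)} {φ : ℝ × ℝ → ℝ} (h : IsTest D φ) :
    Continuous (d1 φ) :=
  (h.smooth.continuous_fderiv (by simp)).clm_apply continuous_const

theorem IsTest.continuous_d2 {D : Set (ℝ × ℝ)} {φ : ℝ × ℝ → ℝ} (h : IsTest D φ) :
    Continuous (d2 φ) :=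
  (h.smooth.continuous_fderiv (by simp)).clm_apply continuous_const

theorem IsTest.compact_d1 {D : Set (ℝ × ℝ)} {φ : ℝ × ℝ → ℝ} (h : IsTest D φ) :
    HasCompactSupport (d1 φ) :=
  (h.compact.fderiv (𝕜 := ℝ)).comp_left (g := fun L : ℝ × ℝ →L[ℝ] ℝ => L (1, 0)) rfl

theorem IsTest.compact_d2 {D : Set (ℝ × ℝ)} {φ : ℝ × ℝ → ℝ} (h : IsTest D φ) :
    HasCompactSupport (d2 φ) :=
  (h.compact.fderiv (𝕜 := ℝ)).comp_left (g := fun L : ℝ × ℝ →L[ℝ] ℝ => L (0, 1)) rfl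

theorem IsL2Loc.locallyIntegrable {E : Type*} [NormedAddCommGroup E] {f : ℝ × ℝ → E}
    (h : IsL2Loc f) : LocallyIntegrable f := by
  rw [locallyIntegrable_iff]
  intro K hK
  have : IsFiniteMeasure (volume.restrict K : Measure (ℝ × ℝ)) :=
    ⟨by simpa using hK.measure_lt_top⟩
  exact (h K hK).integrable (by norm_num)

theorem IsL2Loc.comp {f : ℝ × ℝ → C2} (h : IsL2Loc f) (i : Fin 2) :
    IsL2Loc (fun x => f x i) := fun K hK =>
  (EuclideanSpace.proj (𝕜 := ℂ) i).comp_memLp' (h K hK)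

theorem integrable_test {g : ℝ × ℝ → ℝ} (hg : Continuous g) (hc : HasCompactSupport g)
    {f : ℝ × ℝ → ℂ} (hf : IsL2Loc f) : Integrable (fun x => g x • f x) :=
  hf.locallyIntegrable.integrable_smul_left_of_hasCompactSupport hg hc

theorem IsH1Loc.add {U V : ℝ × ℝ → ℂ} {P R : ℝ × ℝ → C2} (h : IsH1Loc U P) (h' : IsH1Loc V R) :
    IsH1Loc (fun x => U x + V x) (fun x => P x + R x) where
  fn := fun K hK => (h.fn K hK).add (h'.fn K hK)
  grad := fun K hK => (h.grad K hK).add (h'.grad K hK)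
  weak1 := fun φ hφ => by
    have e1 := h.weak1 φ hφ
    have e2 := h'.weak1 φ hφ
    simp only [smul_add, PiLp.add_apply]
    rw [integral_add (integrable_test hφ.continuous_d1 hφ.compact_d1 h.fn)
        (integrable_test hφ.continuous_d1 hφ.compact_d1 h'.fn),
      integral_add (integrable_test hφ.smooth.continuous hφ.compact (h.grad.comp 0))
        (integrable_test hφ.smooth.continuous hφ.compact (h'.grad.comp 0)), e1, e2]
    ring
  weak2 := fun φ hφ => by
    have e1 := h.weak2 φ hφ
    have e2 := h'.weak2 φ hφ
    simp only [smul_add, PiLp.add_apply]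
    rw [integral_add (integrable_test hφ.continuous_d2 hφ.compact_d2 h.fn)
        (integrable_test hφ.continuous_d2 hφ.compact_d2 h'.fn),
      integral_add (integrable_test hφ.smooth.continuous hφ.compact (h.grad.comp 1))
        (integrable_test hφ.smooth.continuous hφ.compact (h'.grad.comp 1)), e1, e2]
    ring

theorem IsH1Loc.smul {U : ℝ × ℝ → ℂ} {P : ℝ × ℝ → C2} (h : IsH1Loc U P) (c : ℂ) :
    IsH1Loc (fun x => c • U x) (fun x => c • P x) where
  fn := fun K hK => (h.fn K hK).const_smul c
  grad := fun K hK => (h.grad K hK).const_smul c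
  weak1 := fun φ hφ => by
    simp only [PiLp.smul_apply, smul_comm _ c, integral_smul, h.weak1 φ hφ, smul_neg]
  weak2 := fun φ hφ => by
    simp only [PiLp.smul_apply, smul_comm _ c, integral_smul, h.weak2 φ hφ, smul_neg]

/-- The space `H¹_α(D)` for an open set `D`: the restrictions `u = U|_D` of the `α`-quasi-periodic
functions `U ∈ H¹_loc(ℝ²)` that belong to `H¹(D)`. An element is stored as the pair `(u, ∇u)` of
`u ∈ L²(D)` and its weak gradient `∇u = ∇U|_D ∈ L²(D, ℂ²)`, which is determined by `u`; the norm
inherited from the `ℓ²`-product is the norm of `H¹(D)`. -/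
def H1Sub (D : Set (ℝ × ℝ)) (α : ℝ) : Submodule ℂ (WithLp 2 (L2 D × L2v D)) where
  carrier := {u | ∃ U P, IsH1Loc U P ∧ IsQuasiPeriodic α U ∧
    (∀ᵐ x ∂(volume.restrict D), u.fst x = U x) ∧ (∀ᵐ x ∂(volume.restrict D), u.snd x = P x)}
  add_mem' := by
    rintro u v ⟨U, P, h1, h2, h3, h4⟩ ⟨V, R, k1, k2, k3, k4⟩
    refine ⟨_, _, h1.add k1, ?_, ?_, ?_⟩
    · filter_upwards [h2, k2] with x hx kx
      rw [hx, kx]; ring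
    · filter_upwards [h3, k3, Lp.coeFn_add u.fst v.fst] with x hx kx e
      rw [WithLp.add_fst, e, Pi.add_apply, hx, kx]
    · filter_upwards [h4, k4, Lp.coeFn_add u.snd v.snd] with x hx kx e
      rw [WithLp.add_snd, e, Pi.add_apply, hx, kx]
  zero_mem' := by
    refine ⟨fun _ => 0, fun _ => 0, ⟨fun K _ => MemLp.zero', fun K _ => MemLp.zero', ?_, ?_⟩,
      ?_, ?_, ?_⟩
    · simp
    · simp
    · simp [IsQuasiPeriodic]
    · exact Lp.coeFn_zero _ _ _
    · exact Lp.coeFn_zero _ _ _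
  smul_mem' := by
    rintro c u ⟨U, P, h1, h2, h3, h4⟩
    refine ⟨_, _, h1.smul c, ?_, ?_, ?_⟩
    · filter_upwards [h2] with x hx
      rw [hx]; simp only [smul_eq_mul]; ring
    · filter_upwards [h3, Lp.coeFn_smul c u.fst] with x hx e
      rw [WithLp.smul_fst, e, Pi.smul_apply, hx]
    · filter_upwards [h4, Lp.coeFn_smul c u.snd] with x hx e
      rw [WithLp.smul_snd, e, Pi.smul_apply, hx]

/-- `H¹_α(D)` as a type. -/
abbrev H1 (D : Set (ℝ × ℝ)) (α : ℝ) : Type := H1Sub D α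

/-- The function `u ∈ L²(D)` underlying an element of `H¹_α(D)`. -/
def H1.fn {D : Set (ℝ × ℝ)} {α : ℝ} (u : H1 D α) : L2 D := u.1.fst

/-- The weak gradient `∇u ∈ L²(D, ℂ²)` of an element of `H¹_α(D)`. -/
def H1.grad {D : Set (ℝ × ℝ)} {α : ℝ} (u : H1 D α) : L2v D := u.1.snd

/-! ### The quasi-periodic Green's function and the operator `L_k = div V_k` -/

/-- `α_j = j + α`. -/
def alphaJ (α : ℝ) (j : ℤ) : ℝ := j + α

/-- `β_j = (k² - α_j²)^{1/2}`, the root being nonnegative or having positive imaginary part. -/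
def betaJ (k α : ℝ) (j : ℤ) : ℂ :=
  if alphaJ α j ^ 2 ≤ k ^ 2 then (√(k ^ 2 - alphaJ α j ^ 2) : ℂ)
  else Complex.I * (√(alphaJ α j ^ 2 - k ^ 2) : ℂ)

/-- The `α`-quasi-periodic Green's function
`G(x) = i/(4π) ∑_j β_j⁻¹ exp(i α_j x₁ + i β_j |x₂|)`; the series converges absolutely for all `x`
with `x₂ ≠ 0`, that is, almost everywhere, and only these values enter below. -/
def green (k α : ℝ) (x : ℝ × ℝ) : ℂ :=
  Complex.I / (4 * Real.pi) * ∑' j : ℤ, (betaJ k α j)⁻¹ *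
    Complex.exp (Complex.I * alphaJ α j * x.1 + Complex.I * betaJ k α j * |x.2|)

/-- The volume potential `(V_k g)(x) = ∫_D G(x - y) g(y) dy`, componentwise. -/
def volPot (k α : ℝ) (D : Set (ℝ × ℝ)) (g : L2v D) (x : ℝ × ℝ) : C2 :=
  ∫ y in D, green k α (x - y) • g y

/-- `w = L_k g` in `H¹_α(D)`, where `L_k g = div V_k g`: the function `w ∈ H¹_α(D)` is the weak
divergence of the volume potential `V_k g` in `D`. -/
structure IsLk (k α : ℝ) (D : Set (ℝ × ℝ)) (g : L2v D) (w : H1 D α) : Prop where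
  locInt : LocallyIntegrableOn (volPot k α D g) D
  weakDiv : ∀ φ, IsTest D φ → ∫ x in D, φ x • w.fn x =
    -∫ x in D, (d1 φ x • volPot k α D g x 0 + d2 φ x • volPot k α D g x 1)

/-! ### The contrast and the weighted space -/

/-- `Re A = (A + A*)/2`. -/
def reM (A : Matrix (Fin 2) (Fin 2) ℂ) : Matrix (Fin 2) (Fin 2) ℂ :=
  (2⁻¹ : ℂ) • (A + A.conjTranspose)

/-- `Im A = (A - A*)/(2i)`. -/
def imM (A : Matrix (Fin 2) (Fin 2) ℂ) : Matrix (Fin 2) (Fin 2) ℂ :=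
  (2 * Complex.I)⁻¹ • (A - A.conjTranspose)

/-- The matrix `A` applied to a vector of `ℂ²`. -/
def act (A : Matrix (Fin 2) (Fin 2) ℂ) (ξ : C2) : C2 := Matrix.toEuclideanCLM (𝕜 := ℂ) A ξ

/-- `|Re A|^{1/2}`, through the spectral calculus of the Hermitian matrix `Re A`. -/
def sqrtAbsRe (A : Matrix (Fin 2) (Fin 2) ℂ) : Matrix (Fin 2) (Fin 2) ℂ :=
  cfc (fun t : ℝ => √|t|) (reM A)

section
open scoped ComplexOrder

/-- A contrast `Q ∈ L^∞(D, ℂ^{2×2})` such that `Re Q(x)` is strictly positive definite or strictly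
negative definite at almost every `x ∈ D` (which of the two may depend on `x`, and there need not
be a uniform bound away from zero). -/
structure Contrast (D : Set (ℝ × ℝ)) where
  toFun : ℝ × ℝ → Matrix (Fin 2) (Fin 2) ℂ
  meas : ∀ i j, AEStronglyMeasurable (fun x => toFun x i j) (volume.restrict D)
  bdd : ∃ M : ℝ, ∀ᵐ x ∂(volume.restrict D), ∀ i j, ‖toFun x i j‖ ≤ M
  definite : ∀ᵐ x ∂(volume.restrict D), (reM (toFun x)).PosDef ∨ (-reM (toFun x)).PosDef

end

theorem isSelfAdjoint_reM (A : Matrix (Fin 2) (Fin 2) ℂ) : IsSelfAdjoint (reM A) := by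
  rw [isSelfAdjoint_iff, Matrix.star_eq_conjTranspose, reM]
  simp [Matrix.conjTranspose_smul, add_comm]

theorem continuous_act : Continuous fun z : Matrix (Fin 2) (Fin 2) ℂ × C2 => act z.1 z.2 := by
  refine (PiLp.continuous_toLp 2 _).comp ?_
  exact continuous_fst.matrix_mulVec ((PiLp.continuous_ofLp 2 _).comp continuous_snd)

section
open scoped Matrix.Norms.L2Operator

theorem continuous_sqrtAbsRe : Continuous sqrtAbsRe := by
  have h : Continuous reM := by
    unfold reM
    fun_prop
  exact Continuous.cfc_of_mem_nhdsSet (s := univ) (fun t : ℝ => √|t|) Filter.univ_mem h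
    (fun A => isSelfAdjoint_reM A) (by fun_prop)

theorem norm_act_le (A : Matrix (Fin 2) (Fin 2) ℂ) (ξ : C2) : ‖act A ξ‖ ≤ ‖A‖ * ‖ξ‖ :=
  (Matrix.toEuclideanCLM (𝕜 := ℂ) A).le_opNorm ξ

theorem exists_bound_sqrtAbsRe (M : ℝ) : ∃ c : ℝ, ∀ A : Matrix (Fin 2) (Fin 2) ℂ,
    (∀ i j, ‖A i j‖ ≤ M) → ∀ ξ, ‖act (sqrtAbsRe A) ξ‖ ≤ c * ‖ξ‖ := by
  have hK : IsCompact (univ.pi fun _ : Fin 2 => univ.pi fun _ : Fin 2 =>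
      Metric.closedBall (0 : ℂ) M) :=
    isCompact_univ_pi fun _ => isCompact_univ_pi fun _ => isCompact_closedBall _ _
  obtain ⟨c, hc⟩ := IsCompact.exists_bound_of_continuousOn (E := Matrix (Fin 2) (Fin 2) ℂ)
    (α := Matrix (Fin 2) (Fin 2) ℂ) hK continuous_sqrtAbsRe.continuousOn
  refine ⟨c, fun A hA ξ => (norm_act_le _ _).trans ?_⟩
  refine mul_le_mul_of_nonneg_right (hc A ?_) (norm_nonneg _)
  exact fun i _ j _ => by simpa using hA i j

end

theorem continuous_sqrtAbsRe' : Continuous sqrtAbsRe := continuous_sqrtAbsRe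

theorem Contrast.aestronglyMeasurable {D : Set (ℝ × ℝ)} (Q : Contrast D) :
    AEStronglyMeasurable Q.toFun (volume.restrict D) := by
  have h : AEMeasurable (β := Fin 2 → Fin 2 → ℂ) Q.toFun (volume.restrict D) :=
    aemeasurable_pi_lambda (X := fun _ : Fin 2 => Fin 2 → ℂ) _ fun i =>
      aemeasurable_pi_lambda (X := fun _ : Fin 2 => ℂ) _ fun j => (Q.meas i j).aemeasurable
  exact h.aestronglyMeasurable

theorem Contrast.aestronglyMeasurable_sqrt {D : Set (ℝ × ℝ)} (Q : Contrast D) :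
    AEStronglyMeasurable (fun x => sqrtAbsRe (Q.toFun x)) (volume.restrict D) :=
  continuous_sqrtAbsRe'.comp_aestronglyMeasurable Q.aestronglyMeasurable

theorem aestronglyMeasurable_act {μ : Measure (ℝ × ℝ)} {A : ℝ × ℝ → Matrix (Fin 2) (Fin 2) ℂ}
    {p : ℝ × ℝ → C2} (hA : AEStronglyMeasurable A μ) (hp : AEStronglyMeasurable p μ) :
    AEStronglyMeasurable (fun x => act (A x) (p x)) μ := by
  have h := hA.prodMk hp
  have h' := Continuous.comp_aestronglyMeasurable (g := fun z : _ × C2 => act z.1 z.2)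
    continuous_act h
  exact h'

theorem Contrast.exists_bound {D : Set (ℝ × ℝ)} (Q : Contrast D) (p : L2v D) :
    ∃ c : ℝ, ∀ᵐ x ∂(volume.restrict D),
      ‖act (sqrtAbsRe (Q.toFun x)) (p x)‖ ≤ c * ‖p x‖ :=
  Q.bdd.elim fun M hM => (exists_bound_sqrtAbsRe M).elim fun c hc =>
    ⟨c, hM.mono fun _ hx => hc _ hx _⟩

theorem Contrast.memLp {D : Set (ℝ × ℝ)} (Q : Contrast D) (p : L2v D) :
    MemLp (fun x => act (sqrtAbsRe (Q.toFun x)) (p x)) 2 (volume.restrict D) :=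
  (Q.exists_bound p).elim fun _ hc =>
    MemLp.of_le_mul (Lp.memLp p) (aestronglyMeasurable_act Q.aestronglyMeasurable_sqrt (Lp.aestronglyMeasurable p)) hc

/-- The map `u ↦ (u, |Re Q|^{1/2} ∇u)` from `H¹_α(D)` to `L²(D) × L²(D, ℂ²)`. -/
def weightMap {D : Set (ℝ × ℝ)} (α : ℝ) (Q : Contrast D) :
    H1 D α →ₗ[ℂ] WithLp 2 (L2 D × L2v D) where
  toFun u := WithLp.toLp 2 (u.fn, (Q.memLp u.grad).toLp _)
  map_add' u v := by
    refine congrArg (WithLp.toLp 2) (Prod.ext rfl ?_)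
    apply Lp.ext
    filter_upwards [(Q.memLp (u + v).grad).coeFn_toLp, (Q.memLp u.grad).coeFn_toLp,
      (Q.memLp v.grad).coeFn_toLp, Lp.coeFn_add u.grad v.grad,
      Lp.coeFn_add ((Q.memLp u.grad).toLp _) ((Q.memLp v.grad).toLp _)] with x h1 h2 h3 h4 h5
    refine h1.trans (Eq.trans ?_ h5.symm)
    rw [Pi.add_apply, h2, h3, show (u + v).grad = u.grad + v.grad from rfl, h4]
    exact map_add (Matrix.toEuclideanCLM (𝕜 := ℂ) (sqrtAbsRe (Q.toFun x))) _ _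
  map_smul' c u := by
    refine congrArg (WithLp.toLp 2) (Prod.ext rfl ?_)
    apply Lp.ext
    filter_upwards [(Q.memLp (c • u).grad).coeFn_toLp, (Q.memLp u.grad).coeFn_toLp,
      Lp.coeFn_smul c u.grad, Lp.coeFn_smul c ((Q.memLp u.grad).toLp _)] with x h1 h2 h3 h4
    refine h1.trans (Eq.trans ?_ h4.symm)
    rw [Pi.smul_apply, h2, show (c • u).grad = c • u.grad from rfl, h3]
    exact map_smul (Matrix.toEuclideanCLM (𝕜 := ℂ) (sqrtAbsRe (Q.toFun x))) _ _

/-- The vector space `H¹_α(D)` under the weighted norm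
`‖u‖² = ‖|Re Q|^{1/2} ∇u‖²_{L²(D, ℂ²)} + ‖u‖²_{L²(D)}`. -/
def PreH1Q {D : Set (ℝ × ℝ)} (α : ℝ) (_Q : Contrast D) : Type := H1 D α

instance {D : Set (ℝ × ℝ)} (α : ℝ) (Q : Contrast D) : AddCommGroup (PreH1Q α Q) :=
  inferInstanceAs (AddCommGroup (H1 D α))

instance {D : Set (ℝ × ℝ)} (α : ℝ) (Q : Contrast D) : Module ℂ (PreH1Q α Q) :=
  inferInstanceAs (Module ℂ (H1 D α))

/-- `weightMap`, on the copy of `H¹_α(D)` that carries the weighted norm. -/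
def preWeightMap {D : Set (ℝ × ℝ)} (α : ℝ) (Q : Contrast D) :
    PreH1Q α Q →ₗ[ℂ] WithLp 2 (L2 D × L2v D) := weightMap α Q

instance {D : Set (ℝ × ℝ)} (α : ℝ) (Q : Contrast D) : SeminormedAddCommGroup (PreH1Q α Q) :=
  SeminormedAddCommGroup.induced _ _ (preWeightMap α Q)

instance {D : Set (ℝ × ℝ)} (α : ℝ) (Q : Contrast D) : NormedSpace ℂ (PreH1Q α Q) :=
  NormedSpace.induced ℂ _ _ (preWeightMap α Q)

theorem norm_sq_preH1Q {D : Set (ℝ × ℝ)} (α : ℝ) (Q : Contrast D) (u : H1 D α) :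
    ‖(show PreH1Q α Q from u)‖ ^ 2 = ‖(Q.memLp u.grad).toLp _‖ ^ 2 + ‖u.fn‖ ^ 2 := by
  rw [add_comm]
  exact WithLp.prod_norm_sq_eq_of_L2 (weightMap α Q u)

/-- The weighted space `H¹_{α,Q}(D)`: the completion of `H¹_α(D)` in the weighted norm. -/
abbrev H1Q {D : Set (ℝ × ℝ)} (α : ℝ) (Q : Contrast D) : Type :=
  UniformSpace.Completion (PreH1Q α Q)

/-- The canonical embedding of `H¹_α(D)` into `H¹_{α,Q}(D)`. -/
def H1.toH1Q {D : Set (ℝ × ℝ)} {α : ℝ} (Q : Contrast D) (u : H1 D α) : H1Q α Q :=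
  ((show PreH1Q α Q from u : PreH1Q α Q) : UniformSpace.Completion (PreH1Q α Q))

/-- The isometric extension of `u ↦ (u, |Re Q|^{1/2} ∇u)` to `H¹_{α,Q}(D)`. -/
def weightMapQ {D : Set (ℝ × ℝ)} (α : ℝ) (Q : Contrast D) :
    H1Q α Q →L[ℂ] WithLp 2 (L2 D × L2v D) :=
  ((preWeightMap α Q).mkContinuous 1 fun u => by rw [one_mul]; exact le_rfl).fromCompletion

/-- The gradient of `v ∈ H¹_{α,Q}(D)`: the measurable field `∇v`, unique almost everywhere in
`D`, such that `|Re Q|^{1/2} ∇v` is the limit in `L²(D, ℂ²)` of `|Re Q|^{1/2} ∇u_n` whenever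
`u_n ∈ H¹_α(D)` and `u_n → v` in `H¹_{α,Q}(D)`. (The matrix is invertible almost everywhere.) -/
def gradQ {D : Set (ℝ × ℝ)} {α : ℝ} {Q : Contrast D} (v : H1Q α Q) (x : ℝ × ℝ) : C2 :=
  act (sqrtAbsRe (Q.toFun x))⁻¹ ((weightMapQ α Q v).snd x)

/-! ### Solutions of the Lippmann–Schwinger equation -/

/-- `u ∈ H¹_α(D)` solves `u = L_k(Q∇u + f)` in `H¹_α(D)`. -/
def SolvesH1 {D : Set (ℝ × ℝ)} {α : ℝ} (k : ℝ) (Q : Contrast D) (f : L2v D) (u : H1 D α) :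
    Prop :=
  ∃ g : L2v D, (∀ᵐ x ∂(volume.restrict D), g x = act (Q.toFun x) (u.grad x) + f x) ∧
    IsLk k α D g u

/-- `v ∈ H¹_{α,Q}(D)` solves `v = L_k(Q∇v + f)` in `H¹_{α,Q}(D)`: the field `Q∇v + f` lies in
`L²(D, ℂ²)`, and `v` is the image in `H¹_{α,Q}(D)` of the element `L_k(Q∇v + f)` of `H¹_α(D)`. -/
def SolvesH1Q {D : Set (ℝ × ℝ)} {α : ℝ} (k : ℝ) (Q : Contrast D) (f : L2v D) (v : H1Q α Q) :
    Prop :=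
  ∃ g : L2v D, (∀ᵐ x ∂(volume.restrict D), g x = act (Q.toFun x) (gradQ v x) + f x) ∧
    ∃ w : H1 D α, IsLk k α D g w ∧ v = w.toH1Q Q

end Grating

end

noncomputable section

namespace Grating

/-! ### A finite measure equivalent to Lebesgue measure for which characters are orthogonal -/

/-! The analytic content is that `L_k` maps `L²(D, ℂ²)` into `H¹_α(D)`; the transfer between the two
solution concepts is then nearly formal.

Existence of `L_k g`. Expand in quasi-periodic Fourier modes `exp(iα_j x₁)`. The `j`-th mode of `V_k
g` is a multiple of `β_j⁻¹` times the convolution in `x₂` of the Fourier coefficient of `g` with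
`exp(iβ_j|t|)`. Up to finitely many `j`, `Im β_j` is bounded below by a multiple of `1 + |j|`, so by
Schur's test this convolution has norm `O(1/(1 + |j|))` on `L²`. Together with `β_j⁻¹` this gains
two powers of `|j|`. The divergence costs one, and the other leaves one derivative: the modes `u_j`
of the divergence satisfy `∑ (1 + |j|)² ‖u_j‖² < ∞`, and their weak derivatives `u_j'` are square
summable. The derivatives in `x₂` come from `(exp(iβ|t|))' = iβ sgn(t) exp(iβ|t|)` and `(sgn(t)
exp(iβ|t|))' = 2δ + iβ exp(iβ|t|)`.

To sum the modes once and for all, `L²_loc` is replaced by the Hilbert space `L²(planeMeas)`. There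
distinct modes are orthogonal, so square summability gives convergence (`summable_mode`), and
pairing with a test function is continuous (`exists_pairing`), so weak derivatives pass to the sum
(`exists_isH1Loc_of_modes`). That the sum is the weak divergence of `V_k g` follows because the
Green series converges absolutely in `L¹_loc` (`IsCutoff.series`). All this meets in
`exists_div_volPot`.

Uniqueness. A weak divergence is determined by its pairings with test functions, and a function
vanishing on the open set `D` has zero weak gradient there.

Equivalence. `|Re Q|^{1/2}` is invertible almost everywhere, so the gradient in the completion of
the image of `u` is `∇u` (`gradQ_toH1Q`). A solution in the completion is by definition the image of
some `w = L_k(Q∇v + f)`, and `∇v = ∇w` makes `w` a solution in `H¹_α(D)`. Finally, `|Im Q ξ| ≤ C |Re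
Q ξ|` gives `|Q∇v| ≤ (1 + C) |Re Q ∇v|`, and `|Re Q ∇v|` is the length of the bounded matrix `|Re
Q|^{1/2}` applied to the `L²` field `|Re Q|^{1/2}∇v`. -/

/-- A finite measure on the line, locally equivalent to Lebesgue measure, for which the characters
`exp(inx)` with distinct frequencies `n ∈ ℤ` are orthogonal. -/
def lineMeas : Measure ℝ :=
  Measure.sum fun L : ℕ => ((2 : ℝ≥0∞)⁻¹ ^ (L + 1)) •
    (volume : Measure ℝ).restrict (Ioo (-(L * Real.pi)) (L * Real.pi))

/-- The weights `2⁻¹ ^ (L + 1)` sum to one. -/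
theorem lineMeas_le : lineMeas ≤ volume := by
  refine Measure.le_iff.2 fun s hs => ?_
  rw [lineMeas, Measure.sum_apply _ hs]
  calc ∑' L : ℕ, (((2 : ℝ≥0∞)⁻¹ ^ (L + 1)) •
        (volume : Measure ℝ).restrict (Ioo (-(L * Real.pi)) (L * Real.pi))) s
      ≤ ∑' L : ℕ, (2 : ℝ≥0∞)⁻¹ ^ (L + 1) * volume s := by
        refine ENNReal.tsum_le_tsum fun L => ?_
        rw [Measure.smul_apply, smul_eq_mul]
        exact mul_le_mul_right (Measure.restrict_apply_le _ _) _
    _ = volume s := by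
        rw [ENNReal.tsum_mul_right, ENNReal.tsum_geometric_add_one]
        simp [ENNReal.inv_mul_cancel]

theorem restrict_Ioo_le_lineMeas (L : ℕ) :
    (volume : Measure ℝ).restrict (Ioo (-(L * Real.pi)) (L * Real.pi)) ≤
      ((2 : ℝ≥0∞) ^ (L + 1)) • lineMeas := by
  refine Measure.le_iff.2 fun s hs => ?_
  rw [lineMeas, Measure.smul_apply, Measure.sum_apply _ hs, smul_eq_mul]
  refine le_trans ?_ (mul_le_mul_right (ENNReal.le_tsum L) _)
  rw [Measure.smul_apply, smul_eq_mul, ← mul_assoc, ← mul_pow, ENNReal.mul_inv_cancel (by simp)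
    (by simp), one_pow, one_mul]

instance : IsFiniteMeasure lineMeas := by
  refine ⟨?_⟩
  rw [lineMeas, Measure.sum_apply _ MeasurableSet.univ]
  have h2 : (2 : ℝ≥0∞)⁻¹ = ENNReal.ofReal (1 / 2) := by
    rw [one_div, ENNReal.ofReal_inv_of_pos two_pos, ENNReal.ofReal_ofNat]
  have h : ∀ L : ℕ, (((2 : ℝ≥0∞)⁻¹ ^ (L + 1)) •
      (volume : Measure ℝ).restrict (Ioo (-(L * Real.pi)) (L * Real.pi))) univ =
      ENNReal.ofReal (Real.pi * ((L : ℝ) ^ 1 * (1 / 2 : ℝ) ^ L)) := by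
    intro L
    have h3 : (0 : ℝ) ≤ 1 / 2 := by norm_num
    have h4 : Real.pi * ((L : ℝ) ^ 1 * (1 / 2 : ℝ) ^ L) =
        (1 / 2 : ℝ) ^ (L + 1) * (L * Real.pi - -(L * Real.pi)) := by ring
    rw [h4, ENNReal.ofReal_mul (pow_nonneg h3 _), ENNReal.ofReal_pow h3, ← h2, ← Real.volume_Ioo,
      Measure.smul_apply, Measure.restrict_apply_univ, smul_eq_mul]
  simp_rw [h]
  refine Ne.lt_top (Summable.tsum_ofReal_ne_top ?_)
  have hn : ‖(1 / 2 : ℝ)‖ < 1 := by rw [Real.norm_eq_abs, abs_of_pos] <;> norm_num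
  exact (summable_pow_mul_geometric_of_norm_lt_one 1 hn).mul_left Real.pi

/-- Each interval `(-Lπ, Lπ)` consists of whole periods of `exp(inx)`, so every summand of the
measure contributes zero. -/
theorem integral_exp_lineMeas {n : ℤ} (hn : n ≠ 0) :
    ∫ x : ℝ, Complex.exp (Complex.I * n * x) ∂lineMeas = 0 := by
  have hi : Integrable (fun x : ℝ => Complex.exp (Complex.I * n * x)) lineMeas := by
    refine Integrable.of_bound (C := 1) (by fun_prop) (.of_forall fun x => ?_)
    rw [Complex.norm_exp]
    simp
  rw [lineMeas] at hi ⊢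
  rw [integral_sum_measure hi]
  refine (tsum_congr fun L => ?_).trans tsum_zero
  rw [integral_smul_measure, ← integral_Ioc_eq_integral_Ioo,
    ← intervalIntegral.integral_of_le (neg_le_self (by positivity)),
    integral_exp_mul_complex (by simpa using hn)]
  have : Complex.exp (Complex.I * n * ((L * Real.pi : ℝ) : ℂ)) =
      Complex.exp (Complex.I * n * ((-(L * Real.pi) : ℝ) : ℂ)) := by
    rw [Complex.exp_eq_exp_iff_exists_int]
    refine ⟨n * L, ?_⟩
    push_cast
    ring
  rw [this, sub_self, zero_div, smul_zero]

/-- The product of `lineMeas` with itself, on the plane. -/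
def planeMeas : Measure (ℝ × ℝ) := lineMeas.prod lineMeas

instance : IsFiniteMeasure planeMeas := by unfold planeMeas; infer_instance

/-- A compact set lies in one of the squares that build the measure. Hence `L²(planeMeas)` functions
are in `L²_loc`, and `planeMeas`-null sets are Lebesgue null. -/
theorem exists_restrict_le_planeMeas {K : Set (ℝ × ℝ)} (hK : IsCompact K) :
    ∃ c : ℝ≥0∞, c ≠ ⊤ ∧ (volume : Measure (ℝ × ℝ)).restrict K ≤ c • planeMeas := by
  obtain ⟨r, hr⟩ := hK.isBounded.subset_ball 0
  obtain ⟨L, hL⟩ := exists_nat_gt r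
  set J : Set ℝ := Ioo (-(L * Real.pi)) (L * Real.pi) with hJ
  have hKJ : K ⊆ J ×ˢ J := by
    intro x hx
    have h := hr hx
    have hp := Real.pi_gt_three
    have hL' : (L : ℝ) ≤ L * Real.pi := by nlinarith [(Nat.cast_nonneg L : (0:ℝ) ≤ L)]
    rw [mem_ball_zero_iff, Prod.norm_def, max_lt_iff, Real.norm_eq_abs, Real.norm_eq_abs,
      abs_lt, abs_lt] at h
    exact ⟨⟨by linarith, by linarith⟩, ⟨by linarith, by linarith⟩⟩
  refine ⟨(2 : ℝ≥0∞) ^ (L + 1) * 2 ^ (L + 1), by finiteness, ?_⟩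
  calc (volume : Measure (ℝ × ℝ)).restrict K ≤ volume.restrict (J ×ˢ J) :=
        Measure.restrict_mono hKJ le_rfl
    _ = (volume.restrict J).prod (volume.restrict J) := (Measure.prod_restrict J J).symm
    _ ≤ ((2 : ℝ≥0∞) ^ (L + 1) • lineMeas).prod ((2 : ℝ≥0∞) ^ (L + 1) • lineMeas) :=
        have : SFinite ((2 : ℝ≥0∞) ^ (L + 1) • lineMeas) := inferInstance
        Measure.prod_mono (restrict_Ioo_le_lineMeas L) (restrict_Ioo_le_lineMeas L)
    _ = _ := by
        rw [Measure.prod_smul_left, Measure.prod_smul_right, smul_smul, planeMeas]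

theorem MemLp.isL2Loc {E : Type*} [NormedAddCommGroup E] {F : ℝ × ℝ → E}
    (h : MemLp F 2 planeMeas) : IsL2Loc F := fun _ hK =>
  let ⟨_, hc, hle⟩ := exists_restrict_le_planeMeas hK
  h.of_measure_le_smul hc hle

theorem ae_volume_of_ae_planeMeas {p : ℝ × ℝ → Prop} (h : ∀ᵐ x ∂planeMeas, p x) :
    ∀ᵐ x : ℝ × ℝ, p x := by
  have hu : (univ : Set (ℝ × ℝ)) = ⋃ n : ℕ, Metric.closedBall 0 n :=
    (Metric.iUnion_closedBall_nat 0).symm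
  rw [← Measure.restrict_univ (μ := (volume : Measure (ℝ × ℝ))), hu, ae_restrict_iUnion_iff]
  intro n
  obtain ⟨c, hc, hle⟩ := exists_restrict_le_planeMeas (isCompact_closedBall (0 : ℝ × ℝ) n)
  exact (Measure.absolutelyContinuous_of_le_smul hle) h

/-- Integration against a continuous compactly supported function is continuous on
`L²(planeMeas)`. -/
theorem exists_pairing {ψ : ℝ × ℝ → ℝ} (hψ : Continuous ψ) (hc : HasCompactSupport ψ) :
    ∃ T : Lp ℂ 2 planeMeas →L[ℝ] ℂ, ∀ F, T F = ∫ x, ψ x • F x := by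
  obtain ⟨c, hc', hle⟩ := exists_restrict_le_planeMeas hc
  obtain ⟨M, hM⟩ := hψ.bounded_above_of_compact_support hc
  set K := tsupport ψ with hK
  have hfin : IsFiniteMeasure ((volume : Measure (ℝ × ℝ)).restrict K) :=
    ⟨by simpa using (show IsCompact K from hc).measure_lt_top⟩
  have hψ2 : MemLp (fun x => (ψ x : ℂ)) 2 ((volume : Measure (ℝ × ℝ)).restrict K) :=
    MemLp.of_bound (by fun_prop) M (.of_forall fun x => by simpa using hM x)
  -- Restrict to the support of `ψ`, then take the inner product with `ψ`. As `ψ` is real, the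
  -- conjugation in the first slot is harmless.
  refine ⟨((innerSL ℂ (hψ2.toLp _)).restrictScalars ℝ).comp
    (Lp.LpToLpOfMeasureLeSMul hc' hle), fun F => ?_⟩
  rw [← setIntegral_eq_integral_of_forall_compl_eq_zero (s := K) fun x hx => by
    rw [image_eq_zero_of_notMem_tsupport hx, zero_smul]]
  change inner ℂ (hψ2.toLp _) (Lp.LpToLpOfMeasureLeSMul hc' hle F) = _
  rw [L2.inner_def]
  refine integral_congr_ae ?_
  filter_upwards [hψ2.coeFn_toLp, Lp.coeFn_LpToLpOfMeasureLeSMul hc' hle F] with x h1 h2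
  rw [h1, h2]
  simp [mul_comm]

/-! ### Fourier modes -/

/-- Pythagoras, applied to the orthogonal family of the lines spanned by the `f i`. -/
theorem summable_of_orthogonal {ι E : Type*} [NormedAddCommGroup E] [InnerProductSpace ℂ E]
    [CompleteSpace E] {f : ι → E} (ho : ∀ i j, i ≠ j → inner ℂ (f i) (f j) = 0)
    (hs : Summable fun i => ‖f i‖ ^ 2) : Summable f := by
  have hV : OrthogonalFamily ℂ (fun i => (ℂ ∙ f i : Submodule ℂ E))
      fun i => (ℂ ∙ f i : Submodule ℂ E).subtypeₗᵢ := by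
    intro i j hij v w
    obtain ⟨a, ha⟩ := Submodule.mem_span_singleton.1 v.2
    obtain ⟨b, hb⟩ := Submodule.mem_span_singleton.1 w.2
    simp [← ha, ← hb, inner_smul_left, inner_smul_right, ho i j hij]
  exact (hV.summable_iff_norm_sq_summable
    fun i => ⟨f i, Submodule.mem_span_singleton_self _⟩).2 hs

/-- The function `exp(i a x₁) u(x₂)`. -/
def mode (a : ℝ) (u : ℝ → ℂ) (x : ℝ × ℝ) : ℂ := Complex.exp (Complex.I * a * x.1) * u x.2

theorem norm_exp_I_mul_mul (a x : ℝ) : ‖Complex.exp (Complex.I * a * x)‖ = 1 := by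
  rw [Complex.norm_exp]
  simp

theorem memLp_mode {u : ℝ → ℂ} (hu : MemLp u 2 lineMeas) (a : ℝ) :
    MemLp (mode a u) 2 planeMeas := by
  have h : MemLp (fun x : ℝ × ℝ => u x.2) 2 planeMeas := hu.comp_snd lineMeas
  refine h.of_le (AEStronglyMeasurable.mul (by fun_prop) h.1) (.of_forall fun x => ?_)
  rw [mode, norm_mul, norm_exp_I_mul_mul, one_mul]

/-- The product structure of `planeMeas` separates the variables, so orthogonality of modes is
decided by the frequencies in `x₁` alone. -/
theorem inner_mode {u v : ℝ → ℂ} (hu : MemLp u 2 lineMeas) (hv : MemLp v 2 lineMeas) (a b : ℝ) :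
    inner ℂ ((memLp_mode hu a).toLp _) ((memLp_mode hv b).toLp _) =
      (∫ x : ℝ, Complex.exp (Complex.I * (b - a : ℝ) * x) ∂lineMeas) *
        ∫ t, v t * star (u t) ∂lineMeas := by
  rw [L2.inner_def, ← integral_prod_mul]
  refine integral_congr_ae ?_
  filter_upwards [(memLp_mode hu a).coeFn_toLp, (memLp_mode hv b).coeFn_toLp] with x h1 h2
  rw [h1, h2, mode, mode]
  simp only [RCLike.inner_apply, map_mul, ← Complex.exp_conj, Complex.conj_I, Complex.conj_ofReal]
  rw [show Complex.I * ((b - a : ℝ) : ℂ) * x.1 = Complex.I * b * x.1 + -Complex.I * a * x.1 by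
    push_cast; ring, Complex.exp_add, RCLike.star_def]
  ring

theorem summable_mode (α : ℝ) {u : ℤ → ℝ → ℂ} (hu : ∀ j, MemLp (u j) 2 lineMeas)
    (hs : Summable fun j => ∫ t, ‖u j t‖ ^ 2 ∂lineMeas) :
    Summable fun j => (memLp_mode (hu j) (alphaJ α j)).toLp _ := by
  refine summable_of_orthogonal (fun i j hij => ?_) ?_
  -- The shift `α` cancels in the difference of frequencies, which is therefore a nonzero integer.
  · rw [inner_mode (hu i) (hu j), show alphaJ α j - alphaJ α i = ((j - i : ℤ) : ℝ) by
      unfold alphaJ; push_cast; ring]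
    have := integral_exp_lineMeas (sub_ne_zero.2 hij.symm)
    push_cast at this ⊢
    rw [this, zero_mul]
  · refine (hs.mul_left (lineMeas.real univ)).congr fun j => ?_
    have h := inner_mode (hu j) (hu j) (alphaJ α j) (alphaJ α j)
    rw [inner_self_eq_norm_sq_to_K, sub_self] at h
    have h2 : ∀ t, u j t * star (u j t) = ((‖u j t‖ ^ 2 : ℝ) : ℂ) := fun t => by
      rw [RCLike.star_def, Complex.mul_conj']; push_cast; rfl
    simp only [h2, integral_complex_ofReal, Complex.ofReal_zero, mul_zero, zero_mul,
      Complex.exp_zero, integral_const, Complex.real_smul, mul_one] at h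
    refine Complex.ofReal_injective ?_
    rw [Complex.ofReal_mul, Complex.ofReal_pow]
    exact h.symm

/-! ### Weak derivatives on the line and of modes in the plane -/

/-- `v` is the weak derivative of `u` on the line. -/
def HasWeakDeriv (u v : ℝ → ℂ) : Prop :=
  ∀ ψ : ℝ → ℝ, ContDiff ℝ ∞ ψ → HasCompactSupport ψ →
    ∫ t, deriv ψ t • u t = -∫ t, ψ t • v t

theorem HasWeakDeriv.add {u v u' v' : ℝ → ℂ} (h : HasWeakDeriv u v) (h' : HasWeakDeriv u' v')
    (hu : LocallyIntegrable u) (hv : LocallyIntegrable v)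
    (hu' : LocallyIntegrable u') (hv' : LocallyIntegrable v') :
    HasWeakDeriv (fun t => u t + u' t) (fun t => v t + v' t) := by
  intro ψ hψ hc
  have hd : Continuous (deriv ψ) := hψ.continuous_deriv (by simp)
  have hi : ∀ {f : ℝ → ℂ}, LocallyIntegrable f → Integrable fun t => ψ t • f t :=
    fun hf => hf.integrable_smul_left_of_hasCompactSupport hψ.continuous hc
  have hi' : ∀ {f : ℝ → ℂ}, LocallyIntegrable f → Integrable fun t => deriv ψ t • f t :=
    fun hf => hf.integrable_smul_left_of_hasCompactSupport hd hc.deriv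
  simp only [smul_add]
  rw [integral_add (hi' hu) (hi' hu'), integral_add (hi hv) (hi hv'), h ψ hψ hc, h' ψ hψ hc]
  ring

theorem HasWeakDeriv.const_mul {u v : ℝ → ℂ} (h : HasWeakDeriv u v) (c : ℂ) :
    HasWeakDeriv (fun t => c * u t) (fun t => c * v t) := by
  intro ψ hψ hc
  have h1 := h ψ hψ hc
  simp only [← smul_eq_mul, smul_comm _ c, integral_smul, h1, smul_neg]

theorem hasWeakDeriv_of_hasDerivAt {u v : ℝ → ℂ} (h : ∀ t, HasDerivAt u (v t) t)
    (hv : Continuous v) : HasWeakDeriv u v := by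
  intro ψ hψ hc
  have hu : Continuous u := continuous_iff_continuousAt.2 fun t => (h t).continuousAt
  have hd : Continuous (deriv ψ) := hψ.continuous_deriv (by simp)
  have h0 : ∀ t, HasDerivAt (fun t => ψ t • u t) (ψ t • v t + deriv ψ t • u t) t := fun t =>
    ((hψ.differentiable (by simp)) t).hasDerivAt.smul (h t)
  have i1 : Integrable fun t => ψ t • v t :=
    hv.locallyIntegrable.integrable_smul_left_of_hasCompactSupport hψ.continuous hc
  have i2 : Integrable fun t => deriv ψ t • u t :=
    hu.locallyIntegrable.integrable_smul_left_of_hasCompactSupport hd hc.deriv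
  have i3 : Integrable fun t => ψ t • u t :=
    hu.locallyIntegrable.integrable_smul_left_of_hasCompactSupport hψ.continuous hc
  have := integral_eq_zero_of_hasDerivAt_of_integrable h0 (i1.add i2) i3
  rw [integral_add i1 i2] at this
  linear_combination this

theorem IsTest.slice_snd {φ : ℝ × ℝ → ℝ} (h : IsTest univ φ) (s : ℝ) :
    ContDiff ℝ ∞ (fun t => φ (s, t)) ∧ HasCompactSupport (fun t => φ (s, t)) ∧
      ∀ t, deriv (fun t => φ (s, t)) t = d2 φ (s, t) := by
  refine ⟨h.smooth.comp (contDiff_const.prodMk contDiff_id),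
    HasCompactSupport.intro (h.compact.isCompact.image continuous_snd) fun t ht =>
      image_eq_zero_of_notMem_tsupport fun hx => ht ⟨_, hx, rfl⟩, fun t => ?_⟩
  have h1 := (h.smooth.differentiable (by simp) (s, t)).hasFDerivAt
  exact (h1.comp_hasDerivAt t ((hasDerivAt_const t s).prodMk (hasDerivAt_id t))).deriv

theorem IsTest.slice_fst {φ : ℝ × ℝ → ℝ} (h : IsTest univ φ) (t : ℝ) :
    ContDiff ℝ ∞ (fun s => φ (s, t)) ∧ HasCompactSupport (fun s => φ (s, t)) ∧
      ∀ s, deriv (fun s => φ (s, t)) s = d1 φ (s, t) := by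
  refine ⟨h.smooth.comp (contDiff_id.prodMk contDiff_const),
    HasCompactSupport.intro (h.compact.isCompact.image continuous_fst) fun s hs =>
      image_eq_zero_of_notMem_tsupport fun hx => hs ⟨_, hx, rfl⟩, fun s => ?_⟩
  have h1 := (h.smooth.differentiable (by simp) (s, t)).hasFDerivAt
  exact (h1.comp_hasDerivAt s ((hasDerivAt_id s).prodMk (hasDerivAt_const s t))).deriv

/-- On horizontal slices `u(x₂)` is a constant factor, so only the smooth exponential is
differentiated and `u` needs no regularity. -/
theorem integral_d1_mode {φ : ℝ × ℝ → ℝ} (hφ : IsTest univ φ) {u : ℝ → ℂ}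
    (hu : MemLp u 2 lineMeas) (a : ℝ) :
    ∫ x, d1 φ x • mode a u x = -∫ x, φ x • (Complex.I * a * mode a u x) := by
  have hl := MemLp.isL2Loc (memLp_mode hu a)
  have i1 := integrable_test hφ.continuous_d1 hφ.compact_d1 hl
  have i2 := integrable_test hφ.smooth.continuous hφ.compact
    (MemLp.isL2Loc ((memLp_mode hu a).const_mul (Complex.I * a)))
  have he : HasWeakDeriv (fun s : ℝ => Complex.exp (Complex.I * a * s))
      fun s => Complex.I * a * Complex.exp (Complex.I * a * s) := by
    refine hasWeakDeriv_of_hasDerivAt (fun s => ?_) (by fun_prop)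
    have := ((hasDerivAt_id (s : ℂ)).const_mul (Complex.I * a)).cexp.comp_ofReal
    simpa [mul_comm] using this
  rw [Measure.volume_eq_prod] at i1 i2 ⊢
  rw [integral_prod_symm _ i1, integral_prod_symm _ i2, ← integral_neg]
  refine integral_congr_ae (.of_forall fun t => ?_)
  obtain ⟨h1, h2, h3⟩ := hφ.slice_fst t
  have := congrArg (· * u t) (he _ h1 h2)
  simp only [h3, neg_mul, ← integral_mul_const, smul_mul_assoc] at this
  simpa only [mode, mul_assoc] using this

theorem integral_d2_mode {φ : ℝ × ℝ → ℝ} (hφ : IsTest univ φ) {u v : ℝ → ℂ}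
    (hu : MemLp u 2 lineMeas) (hv : MemLp v 2 lineMeas) (huv : HasWeakDeriv u v) (a : ℝ) :
    ∫ x, d2 φ x • mode a u x = -∫ x, φ x • mode a v x := by
  have i1 := integrable_test hφ.continuous_d2 hφ.compact_d2 (MemLp.isL2Loc (memLp_mode hu a))
  have i2 := integrable_test hφ.smooth.continuous hφ.compact (MemLp.isL2Loc (memLp_mode hv a))
  rw [Measure.volume_eq_prod] at i1 i2 ⊢
  rw [integral_prod _ i1, integral_prod _ i2, ← integral_neg]
  refine integral_congr_ae (.of_forall fun s => ?_)
  obtain ⟨h1, h2, h3⟩ := hφ.slice_snd s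
  have := congrArg (Complex.exp (Complex.I * a * s) * ·) (huv _ h1 h2)
  simp only [h3, mul_neg, ← integral_const_mul, mul_smul_comm] at this
  simpa only [mode] using this

/-! ### One-dimensional convolutions with the kernels `exp(iβ|t|)` and `sgn(t) exp(iβ|t|)` -/

/-- The kernel `exp(iβ|t|)`. -/
def kerE (β : ℂ) (t : ℝ) : ℂ := Complex.exp (Complex.I * β * |t|)

/-- The kernel `sgn(t) exp(iβ|t|)`. -/
def kerS (β : ℂ) (t : ℝ) : ℂ := (if 0 < t then 1 else -1) * kerE β t

theorem continuous_kerE (β : ℂ) : Continuous (kerE β) := by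
  unfold kerE
  fun_prop

theorem measurable_kerS (β : ℂ) : Measurable (kerS β) :=
  (Measurable.ite measurableSet_Ioi measurable_const measurable_const).mul
    (continuous_kerE β).measurable

theorem norm_kerE (β : ℂ) (t : ℝ) : ‖kerE β t‖ = Real.exp (-(β.im * |t|)) := by
  rw [kerE, Complex.norm_exp]
  simp

/-- The convention `kerS β 0 = -1`, rather than `0`, makes this true at `t = 0` as well. -/
theorem norm_kerS (β : ℂ) (t : ℝ) : ‖kerS β t‖ = ‖kerE β t‖ := by
  rw [kerS, norm_mul]
  split_ifs <;> simp

theorem norm_kerE_le_one {β : ℂ} (hβ : 0 ≤ β.im) (t : ℝ) : ‖kerE β t‖ ≤ 1 := by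
  rw [norm_kerE, Real.exp_le_one_iff]
  have := mul_nonneg hβ (abs_nonneg t)
  linarith

/-- The convolution `∫ k(t - s) h(s) ds` on the line. -/
def lineConv (k h : ℝ → ℂ) (t : ℝ) : ℂ := ∫ s, k (t - s) * h s

theorem aestronglyMeasurable_lineConv {k h : ℝ → ℂ} (hk : Measurable k) (hh : Integrable h)
    (μ : Measure ℝ) : AEStronglyMeasurable (lineConv k h) μ := by
  obtain ⟨h', hm, he⟩ := hh.1
  have : lineConv k h = lineConv k h' := by
    funext t
    exact integral_congr_ae (he.mono fun s hs => by simp only [hs])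
  rw [this]
  refine StronglyMeasurable.aestronglyMeasurable ?_
  have h1 : StronglyMeasurable fun p : ℝ × ℝ => k (p.1 - p.2) * h' p.2 :=
    ((hk.comp (by fun_prop)).stronglyMeasurable).mul (hm.comp_measurable measurable_snd)
  exact h1.integral_prod_right

theorem norm_lineConv_le {k h : ℝ → ℂ} (hk1 : ∀ t, ‖k t‖ ≤ 1)
    (hh : Integrable h) (t : ℝ) : ‖lineConv k h t‖ ≤ ∫ s, ‖h s‖ := by
  refine norm_integral_le_of_norm_le hh.norm (.of_forall fun s => ?_)
  rw [norm_mul]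
  exact mul_le_of_le_one_left (norm_nonneg _) (hk1 _)

theorem memLp_lineConv {k h : ℝ → ℂ} (hk : Measurable k) (hk1 : ∀ t, ‖k t‖ ≤ 1)
    (hh : Integrable h) : MemLp (lineConv k h) 2 lineMeas :=
  MemLp.of_bound (aestronglyMeasurable_lineConv hk hh _) _
    (.of_forall fun t => norm_lineConv_le hk1 hh t)

theorem locallyIntegrable_lineConv {k h : ℝ → ℂ} (hk : Measurable k) (hk1 : ∀ t, ‖k t‖ ≤ 1)
    (hh : Integrable h) : LocallyIntegrable (lineConv k h) := by
  rw [locallyIntegrable_iff]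
  intro K hK
  have : IsFiniteMeasure ((volume : Measure ℝ).restrict K) := ⟨by simpa using hK.measure_lt_top⟩
  exact Integrable.of_bound (aestronglyMeasurable_lineConv hk hh _) _
    (.of_forall fun t => norm_lineConv_le hk1 hh t)

/-- Fubini moves the test function onto the kernel, so weak derivatives of a convolution need only
be computed for the translates of the kernel. -/
theorem integral_smul_lineConv {k h : ℝ → ℂ} (hk : Measurable k) (hk1 : ∀ t, ‖k t‖ ≤ 1)
    (hh : Integrable h) {ψ : ℝ → ℝ} (hψ : Integrable ψ) :
    ∫ t, ψ t • lineConv k h t = ∫ s, (∫ t, ψ t • k (t - s)) * h s := by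
  have h1 : Integrable (fun p : ℝ × ℝ => (ψ p.1 : ℂ) * h p.2) (volume.prod volume) :=
    hψ.ofReal.mul_prod hh
  have h2 : Integrable (fun p : ℝ × ℝ => k (p.1 - p.2) * ((ψ p.1 : ℂ) * h p.2))
      (volume.prod volume) :=
    h1.bdd_mul (c := 1) (hk.comp (by fun_prop)).aestronglyMeasurable (.of_forall fun _ => hk1 _)
  have := integral_integral_swap (f := fun t s => k (t - s) * ((ψ t : ℂ) * h s)) h2
  calc _ = ∫ t, ∫ s, k (t - s) * ((ψ t : ℂ) * h s) := by
        refine integral_congr_ae (.of_forall fun t => ?_)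
        simp only [lineConv, Complex.real_smul, ← integral_const_mul]
        congr 1; funext s; ring
    _ = _ := this
    _ = _ := by
        refine integral_congr_ae (.of_forall fun s => ?_)
        simp only [Complex.real_smul, ← integral_mul_const]
        congr 1; funext t; ring

theorem hasDerivAt_exp_mul_sub (γ : ℂ) (s t : ℝ) :
    HasDerivAt (fun t : ℝ => Complex.exp (γ * (t - s : ℝ)))
    (γ * Complex.exp (γ * (t - s : ℝ))) t := by
  have h1 : HasDerivAt (fun z : ℂ => Complex.exp (γ * (z - s)))
      (Complex.exp (γ * (t - s)) * (γ * 1)) t :=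
    (((hasDerivAt_id (t : ℂ)).sub_const (s : ℂ)).const_mul γ).cexp
  have := h1.comp_ofReal
  push_cast
  simpa [mul_comm] using this

theorem smul_exp_properties {ψ : ℝ → ℝ} (hψ : ContDiff ℝ ∞ ψ) (hc : HasCompactSupport ψ)
    (γ : ℂ) (s : ℝ) :
    ContDiff ℝ 1 (fun t : ℝ => ψ t • Complex.exp (γ * (t - s : ℝ))) ∧
    HasCompactSupport (fun t : ℝ => ψ t • Complex.exp (γ * (t - s : ℝ))) ∧
    (∀ t, deriv (fun t : ℝ => ψ t • Complex.exp (γ * (t - s : ℝ))) t =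
      γ * (ψ t • Complex.exp (γ * (t - s : ℝ))) + deriv ψ t • Complex.exp (γ * (t - s : ℝ))) ∧
    Integrable (fun t : ℝ => ψ t • Complex.exp (γ * (t - s : ℝ))) ∧
    Integrable (fun t : ℝ => deriv ψ t • Complex.exp (γ * (t - s : ℝ))) := by
  have hd : Continuous (deriv ψ) := hψ.continuous_deriv (by simp)
  have hψ1 : ContDiff ℝ 1 ψ := hψ.of_le (by simp)
  have he : Continuous fun t : ℝ => Complex.exp (γ * (t - s : ℝ)) := by fun_prop
  refine ⟨?_, hc.smul_right, fun t => ?_,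
    he.locallyIntegrable.integrable_smul_left_of_hasCompactSupport hψ.continuous hc,
    he.locallyIntegrable.integrable_smul_left_of_hasCompactSupport hd hc.deriv⟩
  · refine hψ1.smul ?_
    have : ContDiff ℝ 1 (fun t : ℝ => ((t - s : ℝ) : ℂ)) :=
      Complex.ofRealCLM.contDiff.comp (contDiff_id.sub contDiff_const)
    exact (contDiff_const.mul this).cexp
  · rw [mul_smul_comm]
    exact (((hψ.differentiable (by simp)) t).hasDerivAt.smul (hasDerivAt_exp_mul_sub γ s t)).deriv

/-- Integration by parts on a half-line. The boundary term at `s` is `-ψ s` here and `ψ s` on the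
other half-line, and these signs decide the two kernel derivatives below. -/
theorem integral_Ioi_deriv_smul_exp {ψ : ℝ → ℝ} (hψ : ContDiff ℝ ∞ ψ) (hc : HasCompactSupport ψ)
    (γ : ℂ) (s : ℝ) :
    ∫ t in Ioi s, deriv ψ t • Complex.exp (γ * (t - s : ℝ)) =
      -ψ s - γ * ∫ t in Ioi s, ψ t • Complex.exp (γ * (t - s : ℝ)) := by
  obtain ⟨h1, h2, h3, h4, h5⟩ := smul_exp_properties hψ hc γ s
  have := h2.integral_Ioi_deriv_eq h1 s
  simp only [h3] at this
  rw [integral_add (h4.integrableOn.const_mul γ) h5.integrableOn, integral_const_mul] at this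
  simp at this ⊢
  linear_combination this

theorem integral_Iic_deriv_smul_exp {ψ : ℝ → ℝ} (hψ : ContDiff ℝ ∞ ψ) (hc : HasCompactSupport ψ)
    (γ : ℂ) (s : ℝ) :
    ∫ t in Iic s, deriv ψ t • Complex.exp (γ * (t - s : ℝ)) =
      ψ s - γ * ∫ t in Iic s, ψ t • Complex.exp (γ * (t - s : ℝ)) := by
  obtain ⟨h1, h2, h3, h4, h5⟩ := smul_exp_properties hψ hc γ s
  have := h2.integral_Iic_deriv_eq h1 s
  simp only [h3] at this
  rw [integral_add (h4.integrableOn.const_mul γ) h5.integrableOn, integral_const_mul] at this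
  simp at this ⊢
  linear_combination this

theorem kerE_of_gt {β : ℂ} {s t : ℝ} (h : s < t) :
    kerE β (t - s) = Complex.exp (Complex.I * β * (t - s : ℝ)) := by
  rw [kerE, abs_of_pos (sub_pos.2 h)]

theorem kerE_of_le {β : ℂ} {s t : ℝ} (h : t ≤ s) :
    kerE β (t - s) = Complex.exp (-(Complex.I * β) * (t - s : ℝ)) := by
  rw [kerE, abs_of_nonpos (sub_nonpos.2 h)]
  push_cast
  ring_nf

theorem kerS_of_gt {β : ℂ} {s t : ℝ} (h : s < t) : kerS β (t - s) = kerE β (t - s) := by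
  rw [kerS, if_pos (sub_pos.2 h), one_mul]

theorem kerS_of_le {β : ℂ} {s t : ℝ} (h : t ≤ s) : kerS β (t - s) = -kerE β (t - s) := by
  rw [kerS, if_neg (not_lt.2 (sub_nonpos.2 h)), neg_one_mul]

theorem integral_smul_kerE {β : ℂ} (hβ : 0 ≤ β.im) {ψ : ℝ → ℝ} (hψ : Integrable ψ) (s : ℝ) :
    ∫ t, ψ t • kerE β (t - s) =
      (∫ t in Iic s, ψ t • Complex.exp (-(Complex.I * β) * (t - s : ℝ))) +
        ∫ t in Ioi s, ψ t • Complex.exp (Complex.I * β * (t - s : ℝ)) := by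
  have hi : Integrable fun t => ψ t • kerE β (t - s) := by
    simp only [Complex.real_smul]
    exact hψ.ofReal.mul_bdd (c := 1) ((continuous_kerE β).comp (by fun_prop)).aestronglyMeasurable
      (.of_forall fun _ => norm_kerE_le_one hβ _)
  rw [← integral_add_compl measurableSet_Iic hi (s := Iic s), compl_Iic]
  congr 1
  · exact setIntegral_congr_fun measurableSet_Iic fun t ht => by simp only [kerE_of_le ht]
  · exact setIntegral_congr_fun measurableSet_Ioi fun t ht => by simp only [kerE_of_gt ht]

theorem integral_smul_kerS {β : ℂ} (hβ : 0 ≤ β.im) {ψ : ℝ → ℝ} (hψ : Integrable ψ) (s : ℝ) :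
    ∫ t, ψ t • kerS β (t - s) =
      -(∫ t in Iic s, ψ t • Complex.exp (-(Complex.I * β) * (t - s : ℝ))) +
        ∫ t in Ioi s, ψ t • Complex.exp (Complex.I * β * (t - s : ℝ)) := by
  have hi : Integrable fun t => ψ t • kerS β (t - s) := by
    simp only [Complex.real_smul]
    exact hψ.ofReal.mul_bdd (c := 1) ((measurable_kerS β).comp (by fun_prop)).aestronglyMeasurable
      (.of_forall fun _ => (norm_kerS β _).trans_le (norm_kerE_le_one hβ _))
  rw [← integral_add_compl measurableSet_Iic hi (s := Iic s), compl_Iic, ← integral_neg]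
  congr 1
  · exact setIntegral_congr_fun measurableSet_Iic fun t ht => by
      simp only [kerS_of_le ht, kerE_of_le ht, smul_neg]
  · exact setIntegral_congr_fun measurableSet_Ioi fun t ht => by
      simp only [kerS_of_gt ht, kerE_of_gt ht]

/-- The kernel is continuous at the origin, so the boundary terms of the two half-lines cancel. -/
theorem hasWeakDeriv_lineConv_kerE {β : ℂ} (hβ : 0 ≤ β.im) {h : ℝ → ℂ} (hh : Integrable h) :
    HasWeakDeriv (lineConv (kerE β) h) fun t => Complex.I * β * lineConv (kerS β) h t := by
  intro ψ hψ hc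
  have hd : Continuous (deriv ψ) := hψ.continuous_deriv (by simp)
  have i1 : Integrable ψ := hψ.continuous.integrable_of_hasCompactSupport hc
  have i2 : Integrable (deriv ψ) := hd.integrable_of_hasCompactSupport hc.deriv
  simp only [← smul_eq_mul (Complex.I * β), smul_comm _ (Complex.I * β)]
  rw [integral_smul, integral_smul_lineConv (continuous_kerE β).measurable (norm_kerE_le_one hβ)
      hh i2, integral_smul_lineConv (measurable_kerS β)
      (fun t => (norm_kerS β t).trans_le (norm_kerE_le_one hβ t)) hh i1,
    ← smul_neg, ← integral_neg, smul_eq_mul, ← integral_const_mul]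
  refine integral_congr_ae (.of_forall fun s => ?_)
  simp only
  rw [integral_smul_kerE hβ i2, integral_smul_kerS hβ i1, integral_Ioi_deriv_smul_exp hψ hc,
    integral_Iic_deriv_smul_exp hψ hc]
  ring

/-- The kernel jumps by `2` at the origin: the boundary terms add up to `-2 ψ s` and yield the delta
contribution `2 h`. -/
theorem hasWeakDeriv_lineConv_kerS {β : ℂ} (hβ : 0 ≤ β.im) {h : ℝ → ℂ} (hh : Integrable h) :
    HasWeakDeriv (lineConv (kerS β) h)
      fun t => 2 * h t + Complex.I * β * lineConv (kerE β) h t := by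
  intro ψ hψ hc
  have hd : Continuous (deriv ψ) := hψ.continuous_deriv (by simp)
  have i1 : Integrable ψ := hψ.continuous.integrable_of_hasCompactSupport hc
  have i2 : Integrable (deriv ψ) := hd.integrable_of_hasCompactSupport hc.deriv
  have j1 : Integrable fun t => ψ t • h t :=
    hh.locallyIntegrable.integrable_smul_left_of_hasCompactSupport hψ.continuous hc
  have j2 : Integrable fun t => ψ t • lineConv (kerE β) h t :=
    (locallyIntegrable_lineConv (continuous_kerE β).measurable (norm_kerE_le_one hβ)
      hh).integrable_smul_left_of_hasCompactSupport hψ.continuous hc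
  have hk1 : ∀ t, ‖kerS β t‖ ≤ 1 := fun t => (norm_kerS β t).trans_le (norm_kerE_le_one hβ t)
  have key : ∀ s, ∫ t, deriv ψ t • kerS β (t - s) =
      -2 * ψ s - Complex.I * β * ∫ t, ψ t • kerE β (t - s) := fun s => by
    rw [integral_smul_kerE hβ i1, integral_smul_kerS hβ i2, integral_Ioi_deriv_smul_exp hψ hc,
      integral_Iic_deriv_smul_exp hψ hc]
    ring
  have j3 : Integrable fun s => (∫ t, ψ t • kerE β (t - s)) * h s := by
    refine hh.bdd_mul (c := ∫ t, ‖ψ t‖) ?_ (.of_forall fun s => ?_)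
    · have : StronglyMeasurable fun p : ℝ × ℝ => ψ p.2 • kerE β (p.2 - p.1) :=
        (Continuous.smul (hψ.continuous.comp continuous_snd)
          ((continuous_kerE β).comp (by fun_prop))).stronglyMeasurable
      exact this.integral_prod_right.aestronglyMeasurable
    · refine norm_integral_le_of_norm_le i1.norm (.of_forall fun t => ?_)
      rw [norm_smul]
      exact mul_le_of_le_one_right (norm_nonneg _) (norm_kerE_le_one hβ _)
  rw [integral_smul_lineConv (measurable_kerS β) hk1 hh i2]
  simp only [smul_add, ← smul_eq_mul (2 : ℂ), ← smul_eq_mul (Complex.I * β),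
    smul_comm _ (Complex.I * β), smul_comm _ (2 : ℂ)]
  rw [integral_add (j1.fun_smul (2 : ℂ)) (j2.fun_smul (Complex.I * β)), integral_smul,
    integral_smul,
    integral_smul_lineConv (continuous_kerE β).measurable (norm_kerE_le_one hβ) hh i1]
  simp only [key, smul_eq_mul]
  rw [← integral_const_mul, ← integral_const_mul, ← integral_add (j1.const_mul 2) (j3.const_mul _),
    ← integral_neg]
  refine integral_congr_ae (.of_forall fun s => ?_)
  simp only [Complex.real_smul]
  ring

/-! ### Bounds for the wave numbers and the one-dimensional kernels -/

/-- The weight `1 + |j|`. -/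
def wt (j : ℤ) : ℝ := 1 + |(j : ℝ)|

theorem wt_pos (j : ℤ) : 0 < wt j := by unfold wt; positivity

theorem one_le_wt (j : ℤ) : 1 ≤ wt j := le_add_of_nonneg_right (abs_nonneg _)

/-- Only finitely many integers have `|j| < N`, and they are absorbed into the constant. -/
theorem exists_bound_of_large {f : ℤ → ℝ} {N C : ℝ} (h : ∀ j : ℤ, N ≤ |(j : ℝ)| → f j ≤ C) :
    ∃ C', 0 < C' ∧ ∀ j, f j ≤ C' := by
  have hfin : {j : ℤ | |(j : ℝ)| < N}.Finite := by
    refine (finite_Icc (-⌈N⌉) ⌈N⌉).subset fun j hj => ?_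
    have h1 := abs_lt.1 (show |(j : ℝ)| < N from hj)
    have h2 := Int.le_ceil N
    constructor
    · have : (-⌈N⌉ : ℝ) ≤ j := by linarith [h1.1]
      exact_mod_cast this
    · have : (j : ℝ) ≤ ⌈N⌉ := by linarith [h1.2]
      exact_mod_cast this
  obtain ⟨M, hM⟩ := (hfin.image f).bddAbove
  refine ⟨max (max C M) 1, by positivity, fun j => ?_⟩
  by_cases hj : N ≤ |(j : ℝ)|
  · exact (h j hj).trans ((le_max_left _ _).trans (le_max_left _ _))
  · exact (hM ⟨j, not_le.1 hj, rfl⟩).trans ((le_max_right _ _).trans (le_max_left _ _))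

theorem betaJ_im_nonneg (k α : ℝ) (j : ℤ) : 0 ≤ (betaJ k α j).im := by
  unfold betaJ
  split_ifs <;> simp [Real.sqrt_nonneg]

theorem norm_betaJ (k α : ℝ) (j : ℤ) : ‖betaJ k α j‖ = √|k ^ 2 - alphaJ α j ^ 2| := by
  unfold betaJ
  split_ifs with h
  · rw [Complex.norm_real, Real.norm_of_nonneg (Real.sqrt_nonneg _), abs_of_nonneg (by linarith)]
  · rw [norm_mul, Complex.norm_I, one_mul, Complex.norm_real,
      Real.norm_of_nonneg (Real.sqrt_nonneg _), abs_of_neg (by linarith), neg_sub]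

theorem betaJ_ne_zero {k α : ℝ} (hres : ∀ j : ℤ, k ^ 2 ≠ alphaJ α j ^ 2) (j : ℤ) :
    betaJ k α j ≠ 0 := by
  rw [← norm_pos_iff, norm_betaJ, Real.sqrt_pos, abs_pos]
  exact sub_ne_zero.2 (hres j)

theorem abs_alphaJ_le (α : ℝ) (j : ℤ) : |alphaJ α j| ≤ (1 + |α|) * wt j := by
  have := abs_add_le (j : ℝ) α
  unfold alphaJ wt
  nlinarith [abs_nonneg (j : ℝ), abs_nonneg α]

theorem norm_betaJ_le {k : ℝ} (hk : 0 < k) (α : ℝ) (j : ℤ) :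
    ‖betaJ k α j‖ ≤ (k + 1 + |α|) * wt j := by
  have h1 : √|k ^ 2 - alphaJ α j ^ 2| ≤ k + |alphaJ α j| := by
    rw [Real.sqrt_le_left (by positivity), abs_le]
    have := sq_abs (alphaJ α j)
    constructor <;> nlinarith [abs_nonneg (alphaJ α j)]
  rw [norm_betaJ]
  nlinarith [abs_alphaJ_le α j, one_le_wt j]

/-- For such `j` one has `|α_j| ≥ 3|j|/4` and `k ≤ |j|/4`, so `β_j` is imaginary with `|β_j|² ≥
|j|²/2`. -/
theorem wt_le_betaJ_im {k : ℝ} (hk : 0 < k) (α : ℝ) {j : ℤ} (hj : 4 * (|α| + k + 1) ≤ |(j : ℝ)|) :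
    wt j / 4 ≤ (betaJ k α j).im := by
  have ha := abs_nonneg α
  have h1 : 3 / 4 * |(j : ℝ)| ≤ |alphaJ α j| := by
    have := abs_sub_abs_le_abs_sub (j : ℝ) (-α)
    rw [abs_neg, sub_neg_eq_add] at this
    unfold alphaJ
    linarith
  have h2 : 9 / 16 * |(j : ℝ)| ^ 2 ≤ alphaJ α j ^ 2 := by
    rw [← sq_abs (alphaJ α j)]
    nlinarith [abs_nonneg (j : ℝ)]
  have h3 : k ^ 2 ≤ 1 / 16 * |(j : ℝ)| ^ 2 := by nlinarith
  have h4 : ¬alphaJ α j ^ 2 ≤ k ^ 2 := by nlinarith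
  rw [betaJ, if_neg h4]
  simp only [Complex.mul_im, Complex.I_re, Complex.I_im, Complex.ofReal_re, Complex.ofReal_im,
    mul_zero, one_mul, zero_add]
  refine Real.le_sqrt_of_sq_le ?_
  unfold wt
  nlinarith

theorem exists_bound_inv_betaJ {k : ℝ} (hk : 0 < k) (α : ℝ) :
    ∃ C, 0 < C ∧ ∀ j, ‖(betaJ k α j)⁻¹‖ * wt j ≤ C := by
  refine exists_bound_of_large (N := 4 * (|α| + k + 1)) (C := 4) fun j hj => ?_
  have h1 := wt_le_betaJ_im hk α hj
  have h2 := (le_abs_self _).trans (Complex.abs_im_le_norm (betaJ k α j))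
  have h3 := wt_pos j
  rw [norm_inv, inv_mul_le_iff₀ (by linarith)]
  linarith

theorem lintegral_exp_neg_abs {b : ℝ} (hb : 0 < b) :
    ∫⁻ t : ℝ, ENNReal.ofReal (Real.exp (-(b * |t|))) = ENNReal.ofReal (2 / b) := by
  have h : ∫ t : ℝ, Real.exp (-(b * |t|)) = 2 / b := by
    rw [integral_comp_abs (f := fun t => Real.exp (-(b * t)))]
    simp only [← neg_mul]
    rw [integral_exp_mul_Ioi (by linarith)]
    simp
    ring
  rw [← h, ofReal_integral_eq_lintegral_ofReal]
  · exact Integrable.of_integral_ne_zero (by rw [h]; positivity)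
  · exact .of_forall fun t => (Real.exp_pos _).le

theorem enorm_kerE (β : ℂ) (t : ℝ) :
    ‖kerE β t‖ₑ = ENNReal.ofReal (Real.exp (-(β.im * |t|))) := by
  rw [← norm_kerE, ofReal_norm]

/-- The source of the decay in `j`. For large `j` the full integral is `2 / Im β_j ≤ 8 / wt j`; for
the remaining `j` the kernel is at most one and the mass of `τ` suffices. The measure `τ` is left
free because Schur's test integrates over `lineMeas` in one variable and over a bounded interval in
the other. -/
theorem exists_bound_kerE {k : ℝ} (hk : 0 < k) (α : ℝ) {τ : Measure ℝ} [IsFiniteMeasure τ]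
    (hτ : τ ≤ volume) : ∃ C, 0 < C ∧ ∀ j s,
      ∫⁻ t, ‖kerE (betaJ k α j) (t - s)‖ₑ ∂τ ≤ ENNReal.ofReal (C / wt j) := by
  set N := 4 * (|α| + k + 1) with hN
  have hN0 : 0 < N := by positivity
  refine ⟨max 8 (τ.real univ * (1 + N)), by positivity, fun j s => ?_⟩
  by_cases hj : N ≤ |(j : ℝ)|
  · have h1 := wt_le_betaJ_im hk α hj
    have h2 := wt_pos j
    have h3 : 0 < (betaJ k α j).im := by linarith
    calc _ ≤ ∫⁻ t, ‖kerE (betaJ k α j) (t - s)‖ₑ := lintegral_mono' hτ le_rfl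
      _ = ∫⁻ t, ‖kerE (betaJ k α j) t‖ₑ :=
          lintegral_sub_right_eq_self (μ := volume) (fun t => ‖kerE (betaJ k α j) t‖ₑ) s
      _ = ENNReal.ofReal (2 / (betaJ k α j).im) := by
          simp only [enorm_kerE, lintegral_exp_neg_abs h3]
      _ ≤ _ := by
          refine ENNReal.ofReal_le_ofReal ?_
          rw [div_le_div_iff₀ h3 h2]
          nlinarith [le_max_left 8 (τ.real univ * (1 + N))]
  · calc _ ≤ ∫⁻ _, 1 ∂τ := by
          refine lintegral_mono fun t => ?_
          have := norm_kerE_le_one (betaJ_im_nonneg k α j) (t - s)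
          rw [← ofReal_norm]
          exact ENNReal.ofReal_le_one.2 this
      _ = ENNReal.ofReal (τ.real univ) := by
          rw [lintegral_one, measureReal_def, ENNReal.ofReal_toReal (measure_ne_top _ _)]
      _ ≤ _ := by
          refine ENNReal.ofReal_le_ofReal ?_
          rw [le_div_iff₀ (wt_pos j)]
          refine le_trans ?_ (le_max_right _ _)
          refine mul_le_mul_of_nonneg_left ?_ measureReal_nonneg
          unfold wt
          linarith [not_le.1 hj]

theorem kerE_sub_comm (β : ℂ) (s t : ℝ) : kerE β (t - s) = kerE β (s - t) := by
  rw [kerE, kerE, abs_sub_comm]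

/-! ### Square integrable families -/

/-- Cauchy–Schwarz for the splitting `f g = f^{1/2} · (f^{1/2} g)`. -/
theorem sq_lintegral_mul_le {X : Type*} [MeasurableSpace X] {σ : Measure X} {f g : X → ℝ≥0∞}
    (hf : AEMeasurable f σ) (hg : AEMeasurable g σ) :
    (∫⁻ x, f x * g x ∂σ) ^ 2 ≤ (∫⁻ x, f x ∂σ) * ∫⁻ x, f x * g x ^ 2 ∂σ := by
  have h1 : ∀ x, (f x ^ (1 / 2 : ℝ)) ^ (2 : ℝ) = f x := fun x => by
    rw [← ENNReal.rpow_mul]; norm_num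
  have h := ENNReal.lintegral_mul_le_Lp_mul_Lq σ Real.HolderConjugate.two_two
    (f := fun x => f x ^ (1 / 2 : ℝ)) (g := fun x => f x ^ (1 / 2 : ℝ) * g x)
    (hf.pow_const _) ((hf.pow_const _).mul hg)
  have e1 : ∀ x, (f x ^ (1 / 2 : ℝ)) * (f x ^ (1 / 2 : ℝ) * g x) = f x * g x := fun x => by
    rw [← mul_assoc, ← ENNReal.rpow_add_of_nonneg _ _ (by norm_num) (by norm_num)]
    norm_num
  have e2 : ∀ x, (f x ^ (1 / 2 : ℝ) * g x) ^ (2 : ℝ) = f x * g x ^ 2 := fun x => by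
    rw [ENNReal.mul_rpow_of_nonneg _ _ (by norm_num), h1, ENNReal.rpow_two]
  simp only [Pi.mul_apply, e1, e2, h1] at h
  calc _ ≤ ((∫⁻ x, f x ∂σ) ^ (1 / 2 : ℝ) * (∫⁻ x, f x * g x ^ 2 ∂σ) ^ (1 / 2 : ℝ)) ^ 2 := by
        gcongr
    _ = _ := by
        rw [mul_pow, ← ENNReal.rpow_two, ← ENNReal.rpow_two, ← ENNReal.rpow_mul,
          ← ENNReal.rpow_mul]
        norm_num

/-- Schur's test from `L²(ℝ)` to `L²(lineMeas)`. The integral over `s` may be limited to a set `S`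
carrying `h`. -/
theorem lintegral_sq_lineConv_le {k h : ℝ → ℂ} (hk : Measurable k) (hh : Measurable h)
    {S : Set ℝ} (h0 : ∀ s ∉ S, h s = 0) {b : ℝ≥0∞}
    (h1 : ∀ t, ∫⁻ s in S, ‖k (t - s)‖ₑ ≤ b) (h2 : ∀ s, ∫⁻ t, ‖k (t - s)‖ₑ ∂lineMeas ≤ b) :
    ∫⁻ t, ‖lineConv k h t‖ₑ ^ 2 ∂lineMeas ≤ b ^ 2 * ∫⁻ s, ‖h s‖ₑ ^ 2 := by
  have hp : ∀ t, ‖lineConv k h t‖ₑ ^ 2 ≤ b * ∫⁻ s, ‖k (t - s)‖ₑ * ‖h s‖ₑ ^ 2 := fun t => by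
    have e : ‖lineConv k h t‖ₑ ≤ ∫⁻ s in S, ‖k (t - s)‖ₑ * ‖h s‖ₑ := by
      rw [lineConv, ← setIntegral_eq_integral_of_forall_compl_eq_zero (s := S) fun s hs => by
        rw [h0 s hs, mul_zero]]
      refine (enorm_integral_le_lintegral_enorm _).trans (le_of_eq ?_)
      simp only [enorm_mul]
    calc _ ≤ (∫⁻ s in S, ‖k (t - s)‖ₑ * ‖h s‖ₑ) ^ 2 := by gcongr
      _ ≤ (∫⁻ s in S, ‖k (t - s)‖ₑ) * ∫⁻ s in S, ‖k (t - s)‖ₑ * ‖h s‖ₑ ^ 2 :=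
          sq_lintegral_mul_le (hk.comp (by fun_prop)).enorm.aemeasurable hh.enorm.aemeasurable
      _ ≤ _ := mul_le_mul' (h1 t) (setLIntegral_le_lintegral _ _)
  have hm : Measurable fun p : ℝ × ℝ => ‖k (p.1 - p.2)‖ₑ * ‖h p.2‖ₑ ^ 2 :=
    (hk.comp (by fun_prop)).enorm.mul ((hh.comp measurable_snd).enorm.pow_const 2)
  calc _ ≤ ∫⁻ t, (b * ∫⁻ s, ‖k (t - s)‖ₑ * ‖h s‖ₑ ^ 2) ∂lineMeas := lintegral_mono hp
    _ = b * ∫⁻ t, (∫⁻ s, ‖k (t - s)‖ₑ * ‖h s‖ₑ ^ 2) ∂lineMeas :=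
        lintegral_const_mul _ hm.lintegral_prod_right'
    _ = b * ∫⁻ s, (∫⁻ t, ‖k (t - s)‖ₑ * ‖h s‖ₑ ^ 2 ∂lineMeas) := by
        rw [lintegral_lintegral_swap hm.aemeasurable]
    _ ≤ b * ∫⁻ s, b * ‖h s‖ₑ ^ 2 := by
        gcongr with s
        have hks : Measurable fun t => ‖k (t - s)‖ₑ := (hk.comp (by fun_prop)).enorm
        rw [lintegral_mul_const _ hks]
        gcongr
        exact h2 s
    _ = _ := by
        rw [lintegral_const_mul _ (hh.enorm.pow_const 2), ← mul_assoc, ← sq]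

/-- The family `u` is square integrable, jointly in the index and the variable. -/
structure SqSum (u : ℤ → ℝ → ℂ) : Prop where
  meas : ∀ j, AEStronglyMeasurable (u j) lineMeas
  sum : ∑' j, ∫⁻ t, ‖u j t‖ₑ ^ 2 ∂lineMeas ≠ ⊤

theorem SqSum.memLp {u : ℤ → ℝ → ℂ} (h : SqSum u) (j : ℤ) : MemLp (u j) 2 lineMeas := by
  refine ⟨h.meas j, ?_⟩
  rw [eLpNorm_lt_top_iff_lintegral_rpow_enorm_lt_top (by simp) (by simp)]
  simpa using ENNReal.lt_top_of_tsum_ne_top h.sum j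

theorem SqSum.summable {u : ℤ → ℝ → ℂ} (h : SqSum u) :
    Summable fun j => ∫ t, ‖u j t‖ ^ 2 ∂lineMeas := by
  refine (ENNReal.summable_toReal h.sum).congr fun j => ?_
  rw [integral_eq_lintegral_of_nonneg_ae (.of_forall fun t => by positivity)
    ((continuous_pow 2).comp_aestronglyMeasurable (h.meas j).norm)]
  congr 1
  refine lintegral_congr fun t => ?_
  rw [ENNReal.ofReal_pow (norm_nonneg _), ofReal_norm]

theorem SqSum.add {u v : ℤ → ℝ → ℂ} (hu : SqSum u) (hv : SqSum v) :
    SqSum fun j t => u j t + v j t := by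
  refine ⟨fun j => (hu.meas j).add (hv.meas j), ?_⟩
  refine ne_top_of_le_ne_top (b := ∑' j, (2 * ∫⁻ t, ‖u j t‖ₑ ^ 2 ∂lineMeas +
    2 * ∫⁻ t, ‖v j t‖ₑ ^ 2 ∂lineMeas)) ?_ (ENNReal.tsum_le_tsum fun j => ?_)
  · rw [ENNReal.tsum_add, ENNReal.tsum_mul_left, ENNReal.tsum_mul_left]
    exact ENNReal.add_ne_top.2 ⟨ENNReal.mul_ne_top (by simp) hu.sum,
      ENNReal.mul_ne_top (by simp) hv.sum⟩
  · rw [← lintegral_const_mul' _ _ (by simp), ← lintegral_const_mul' _ _ (by simp),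
      ← lintegral_add_left' (((hu.meas j).enorm.pow_const 2).const_mul 2)]
    refine lintegral_mono fun t => ?_
    have h1 : ‖u j t + v j t‖ ^ 2 ≤ 2 * ‖u j t‖ ^ 2 + 2 * ‖v j t‖ ^ 2 := by
      nlinarith [norm_add_le (u j t) (v j t), norm_nonneg (u j t + v j t),
        sq_nonneg (‖u j t‖ - ‖v j t‖)]
    have h2 := ENNReal.ofReal_le_ofReal h1
    rwa [ENNReal.ofReal_add (by positivity) (by positivity), ENNReal.ofReal_mul (by simp),
      ENNReal.ofReal_mul (by simp), ENNReal.ofReal_pow (norm_nonneg _),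
      ENNReal.ofReal_pow (norm_nonneg _), ENNReal.ofReal_pow (norm_nonneg _),
      ofReal_norm, ofReal_norm, ofReal_norm,
      ENNReal.ofReal_ofNat] at h2

theorem SqSum.mul {u : ℤ → ℝ → ℂ} (hu : SqSum u) {c : ℤ → ℂ} {C : ℝ} (hc : ∀ j, ‖c j‖ ≤ C) :
    SqSum fun j t => c j * u j t := by
  refine ⟨fun j => (hu.meas j).const_mul _, ?_⟩
  refine ne_top_of_le_ne_top (b := ∑' j, ENNReal.ofReal C ^ 2 * ∫⁻ t, ‖u j t‖ₑ ^ 2 ∂lineMeas) ?_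
    (ENNReal.tsum_le_tsum fun j => ?_)
  · rw [ENNReal.tsum_mul_left]
    exact ENNReal.mul_ne_top (by simp) hu.sum
  · rw [← lintegral_const_mul' _ _ (by simp)]
    refine lintegral_mono fun t => ?_
    rw [enorm_mul, mul_pow]
    gcongr
    rw [← ofReal_norm]
    exact ENNReal.ofReal_le_ofReal (hc j)

theorem SqSum.of_volume {h : ℤ → ℝ → ℂ} (hm : ∀ j, Measurable (h j))
    (hs : ∑' j, ∫⁻ s, ‖h j s‖ₑ ^ 2 ≠ ⊤) : SqSum h :=
  ⟨fun j => (hm j).aestronglyMeasurable, ne_top_of_le_ne_top hs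
    (ENNReal.tsum_le_tsum fun _ => lintegral_mono' lineMeas_le le_rfl)⟩

/-- Schur's test bounds the `j`-th convolution by `C / wt j` times the norm of `h j`, with `C`
independent of `j`, so the factor `wt j` is affordable. It serves both kernels, which have the same
modulus. -/
theorem SqSum.lineConv {k : ℝ} (hk : 0 < k) (α ρ : ℝ) {h : ℤ → ℝ → ℂ}
    (hm : ∀ j, Measurable (h j)) (hi : ∀ j, Integrable (h j))
    (h0 : ∀ j, ∀ s ∉ Ioo (-ρ) ρ, h j s = 0)
    (hs : ∑' j, ∫⁻ s, ‖h j s‖ₑ ^ 2 ≠ ⊤) {K : ℤ → ℝ → ℂ} (hKm : ∀ j, Measurable (K j))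
    (hK : ∀ j t, ‖K j t‖ = ‖kerE (betaJ k α j) t‖) :
    SqSum fun j t => wt j * lineConv (K j) (h j) t := by
  obtain ⟨C1, hC1, h1⟩ := exists_bound_kerE hk α lineMeas_le
  obtain ⟨C2, hC2, h2⟩ := exists_bound_kerE hk α
    (Measure.restrict_le_self (μ := (volume : Measure ℝ)) (s := Ioo (-ρ) ρ))
  set C := max C1 C2 with hC
  have hKe : ∀ j t, ‖K j t‖ₑ = ‖kerE (betaJ k α j) t‖ₑ := fun j t => by
    rw [← ofReal_norm, hK, ofReal_norm]
  refine ⟨fun j => ((aestronglyMeasurable_lineConv (hKm j) (hi j) _).const_mul _), ?_⟩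
  refine ne_top_of_le_ne_top (b := ∑' j, ENNReal.ofReal C ^ 2 * ∫⁻ s, ‖h j s‖ₑ ^ 2) ?_
    (ENNReal.tsum_le_tsum fun j => ?_)
  · rw [ENNReal.tsum_mul_left]
    exact ENNReal.mul_ne_top (by simp) hs
  · have hw := wt_pos j
    have hb : ENNReal.ofReal (wt j) * ENNReal.ofReal (C / wt j) = ENNReal.ofReal C := by
      rw [← ENNReal.ofReal_mul hw.le, mul_div_cancel₀ _ hw.ne']
    have := lintegral_sq_lineConv_le (hKm j) (hm j) (h0 j)
      (b := ENNReal.ofReal (C / wt j))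
      (fun t => by
        simp only [hKe, kerE_sub_comm _ _ t]
        refine (h2 j t).trans (ENNReal.ofReal_le_ofReal ?_)
        gcongr
        exact le_max_right _ _)
      (fun s => by
        simp only [hKe]
        refine (h1 j s).trans (ENNReal.ofReal_le_ofReal ?_)
        gcongr
        exact le_max_left _ _)
    have e : ∀ t, ‖(wt j : ℂ) * Grating.lineConv (K j) (h j) t‖ₑ ^ 2 =
        ENNReal.ofReal (wt j) ^ 2 * ‖Grating.lineConv (K j) (h j) t‖ₑ ^ 2 := fun t => by
      rw [enorm_mul, mul_pow]
      congr 2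
      rw [← ofReal_norm, Complex.norm_real, Real.norm_of_nonneg hw.le]
    simp only [e]
    rw [lintegral_const_mul' _ _ (by simp), ← hb, mul_pow, mul_assoc]
    gcongr

/-! ### Fourier coefficients in the periodic variable -/

/-- The quasi-periodic Fourier coefficient `∫ exp(-iα_j y) γ(y, s) dy`. -/
def coef (α : ℝ) (γ : ℝ × ℝ → ℂ) (j : ℤ) (s : ℝ) : ℂ :=
  ∫ y : ℝ, Complex.exp (-(Complex.I * alphaJ α j * y)) * γ (y, s)

/-- The open box `(-π, π) × (-ρ, ρ)`. -/
def box (ρ : ℝ) : Set (ℝ × ℝ) := Ioo (-Real.pi) Real.pi ×ˢ Ioo (-ρ) ρ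

theorem volume_box_lt_top (ρ : ℝ) : volume (box ρ) < ⊤ := by
  rw [box, Measure.volume_eq_prod, Measure.prod_prod]
  exact ENNReal.mul_lt_top measure_Ioo_lt_top measure_Ioo_lt_top

/-- A measurable square integrable density supported in the box. -/
structure IsDensity (ρ : ℝ) (γ : ℝ × ℝ → ℂ) : Prop where
  meas : Measurable γ
  memLp : MemLp γ 2
  supp : ∀ x ∉ box ρ, γ x = 0

theorem norm_exp_neg_I_mul_mul (a x : ℝ) : ‖Complex.exp (-(Complex.I * a * x))‖ = 1 := by
  rw [Complex.norm_exp]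
  simp

theorem IsDensity.integrable {ρ : ℝ} {γ : ℝ × ℝ → ℂ} (h : IsDensity ρ γ) : Integrable γ := by
  have hf : IsFiniteMeasure ((volume : Measure (ℝ × ℝ)).restrict (box ρ)) :=
    ⟨by simpa using volume_box_lt_top ρ⟩
  have h1 : IntegrableOn γ (box ρ) := (h.memLp.restrict (box ρ)).integrable (by norm_num)
  rwa [integrableOn_iff_integrable_of_support_subset] at h1
  exact fun x hx => by_contra fun h' => hx (h.supp x h')

theorem measurable_coef (α : ℝ) {γ : ℝ × ℝ → ℂ} (h : Measurable γ) (j : ℤ) :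
    Measurable (coef α γ j) := by
  have h1 : StronglyMeasurable fun p : ℝ × ℝ =>
      Complex.exp (-(Complex.I * alphaJ α j * p.1)) * γ p :=
    Measurable.stronglyMeasurable (Measurable.mul (by fun_prop) h)
  exact h1.integral_prod_left'.measurable

theorem IsDensity.integrable_exp_mul {ρ : ℝ} {γ : ℝ × ℝ → ℂ} (h : IsDensity ρ γ) (a : ℝ) :
    Integrable fun p : ℝ × ℝ => Complex.exp (-(Complex.I * a * p.1)) * γ p :=
  h.integrable.bdd_mul (c := 1) (by fun_prop)
    (.of_forall fun _ => (norm_exp_neg_I_mul_mul _ _).le)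

theorem IsDensity.integrable_coef {ρ : ℝ} {γ : ℝ × ℝ → ℂ} (h : IsDensity ρ γ) (α : ℝ) (j : ℤ) :
    Integrable (coef α γ j) := by
  have h1 := h.integrable_exp_mul (alphaJ α j)
  rw [Measure.volume_eq_prod] at h1
  exact h1.integral_prod_right

theorem IsDensity.coef_eq_zero {ρ : ℝ} {γ : ℝ × ℝ → ℂ} (h : IsDensity ρ γ) (α : ℝ) (j : ℤ) :
    ∀ s ∉ Ioo (-ρ) ρ, coef α γ j s = 0 := by
  intro s hs
  have : ∀ y, γ (y, s) = 0 := fun y => h.supp _ fun hb => hs hb.2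
  simp [coef, this]

/-- Parseval on the slice at height `s`. If the slice is not square integrable, the right-hand side
is infinite. -/
theorem IsDensity.tsum_sq_coef_le {ρ : ℝ} {γ : ℝ × ℝ → ℂ} (h : IsDensity ρ γ) (α s : ℝ) :
    ∑' j, ‖coef α γ j s‖ₑ ^ 2 ≤ ENNReal.ofReal (2 * Real.pi) * ∫⁻ y, ‖γ (y, s)‖ₑ ^ 2 := by
  have hpi := Real.pi_pos
  by_cases hfin : ∫⁻ y, ‖γ (y, s)‖ₑ ^ 2 = ⊤
  · rw [hfin, ENNReal.mul_top (by simp [hpi])]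
    exact le_top
  -- Modulation by `exp(-iαy)` turns the quasi-periodic coefficients into ordinary Fourier
  -- coefficients on `(-π, π)`.
  set f : ℝ → ℂ := fun y => Complex.exp (-(Complex.I * α * y)) * γ (y, s) with hf
  have hfm : Measurable f := Measurable.mul (by fun_prop) (h.meas.comp (by fun_prop))
  have hfn : ∀ y, ‖f y‖ = ‖γ (y, s)‖ := fun y => by
    rw [hf, norm_mul, norm_exp_neg_I_mul_mul, one_mul]
  have hfe : ∀ y, ‖f y‖ₑ = ‖γ (y, s)‖ₑ := fun y => by rw [← ofReal_norm, hfn, ofReal_norm]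
  have hab : -Real.pi < Real.pi := by linarith
  have hL : MemLp f 2 := by
    refine ⟨hfm.aestronglyMeasurable, ?_⟩
    rw [eLpNorm_lt_top_iff_lintegral_rpow_enorm_lt_top (by simp) (by simp)]
    simpa [hfe] using lt_top_iff_ne_top.2 hfin
  have hsum := hasSum_sq_fourierCoeffOn hab (hL.restrict (Ioc (-Real.pi) Real.pi))
  have hc : ∀ j, coef α γ j s = (2 * Real.pi : ℝ) * fourierCoeffOn hab f j := by
    intro j
    rw [fourierCoeffOn_eq_integral, coef,
      ← setIntegral_eq_integral_of_forall_compl_eq_zero (s := Ioc (-Real.pi) Real.pi) fun y hy => by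
        rw [h.supp _ fun hb => hy (Ioo_subset_Ioc_self hb.1), mul_zero],
      ← intervalIntegral.integral_of_le hab.le, Complex.real_smul, ← mul_assoc]
    rw [show ((2 * Real.pi : ℝ) : ℂ) * ((1 / (Real.pi - -Real.pi) : ℝ) : ℂ) = 1 by
      rw [← Complex.ofReal_mul, ← Complex.ofReal_one]
      congr 1
      field_simp
      ring, one_mul]
    congr 1
    funext y
    rw [fourier_coe_apply, hf, smul_eq_mul, ← mul_assoc, ← Complex.exp_add]
    congr 2
    have : (Real.pi : ℂ) ≠ 0 := by exact_mod_cast hpi.ne'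
    unfold alphaJ
    push_cast
    field_simp
    ring
  have he : ∀ j, ‖coef α γ j s‖ₑ ^ 2 =
      ENNReal.ofReal ((2 * Real.pi) ^ 2 * ‖fourierCoeffOn hab f j‖ ^ 2) := fun j => by
    rw [hc, ← ofReal_norm, ← ENNReal.ofReal_pow (norm_nonneg _), norm_mul, mul_pow,
      Complex.norm_real, Real.norm_of_nonneg (by positivity)]
  simp only [he]
  rw [← ENNReal.ofReal_tsum_of_nonneg (fun j => by positivity) (hsum.mul_left _).summable,
    (hsum.mul_left _).tsum_eq, intervalIntegral.integral_of_le hab.le, smul_eq_mul,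
    show (2 * Real.pi) ^ 2 * ((Real.pi - -Real.pi)⁻¹ * ∫ y in Ioc (-Real.pi) Real.pi, ‖f y‖ ^ 2) =
      2 * Real.pi * ∫ y in Ioc (-Real.pi) Real.pi, ‖f y‖ ^ 2 by field_simp; ring,
    ENNReal.ofReal_mul (by positivity), ofReal_integral_eq_lintegral_ofReal
      ((memLp_two_iff_integrable_sq_norm hfm.aestronglyMeasurable).1 (hL.restrict _))
      (.of_forall fun y => by positivity)]
  refine mul_le_mul_right ?_ _
  refine (setLIntegral_le_lintegral _ _).trans (le_of_eq (lintegral_congr fun y => ?_))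
  rw [ENNReal.ofReal_pow (norm_nonneg _), ofReal_norm, hfe]

theorem IsDensity.tsum_coef_ne_top {ρ : ℝ} {γ : ℝ × ℝ → ℂ} (h : IsDensity ρ γ) (α : ℝ) :
    ∑' j, ∫⁻ s, ‖coef α γ j s‖ₑ ^ 2 ≠ ⊤ := by
  rw [← lintegral_tsum fun j => ((measurable_coef α h.meas j).enorm.pow_const 2).aemeasurable]
  have hm : Measurable fun p : ℝ × ℝ => ‖γ p‖ₑ ^ 2 := h.meas.enorm.pow_const 2
  have hfin : ∫⁻ p, ‖γ p‖ₑ ^ 2 ≠ ⊤ := by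
    have := h.memLp.2
    rw [eLpNorm_lt_top_iff_lintegral_rpow_enorm_lt_top (by simp) (by simp)] at this
    simpa using this.ne
  refine ne_top_of_le_ne_top ?_ (lintegral_mono fun s => h.tsum_sq_coef_le α s)
  rw [lintegral_const_mul' _ _ ENNReal.ofReal_ne_top, ← lintegral_prod_symm' _ hm,
    ← Measure.volume_eq_prod]
  exact ENNReal.mul_ne_top ENNReal.ofReal_ne_top hfin

/-- The convolution of a density with `exp(i a x₁) k(x₂)`. -/
theorem IsDensity.integral_mode_sub {ρ : ℝ} {γ : ℝ × ℝ → ℂ} (h : IsDensity ρ γ) (α : ℝ) (j : ℤ)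
    {k : ℝ → ℂ} (hk : Measurable k) (hk1 : ∀ t, ‖k t‖ ≤ 1) (x : ℝ × ℝ) :
    ∫ y, mode (alphaJ α j) k (x - y) * γ y = mode (alphaJ α j) (lineConv k (coef α γ j)) x := by
  have hi : Integrable fun y : ℝ × ℝ => mode (alphaJ α j) k (x - y) * γ y := by
    refine h.integrable.bdd_mul (c := 1) ?_ (.of_forall fun y => ?_)
    · exact (Measurable.mul (by fun_prop) (hk.comp (by fun_prop))).aestronglyMeasurable
    · rw [mode, norm_mul, norm_exp_I_mul_mul, one_mul]
      exact hk1 _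
  rw [Measure.volume_eq_prod] at hi ⊢
  rw [integral_prod_symm _ hi, mode, lineConv, ← integral_const_mul]
  congr 1
  funext s
  rw [coef, ← integral_const_mul, ← integral_const_mul]
  congr 1
  funext y
  simp only [mode, Prod.fst_sub, Prod.snd_sub]
  rw [show Complex.I * alphaJ α j * ((x.1 - y : ℝ) : ℂ) = Complex.I * alphaJ α j * x.1 +
    -(Complex.I * alphaJ α j * y) by push_cast; ring, Complex.exp_add]
  ring

/-! ### The Fourier series of the volume potential -/

theorem integrable_tsum_of_lintegral {X ι E : Type*} [MeasurableSpace X] [Countable ι]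
    [NormedAddCommGroup E] [NormedSpace ℝ E] [CompleteSpace E] {μ : Measure X} {F : ι → X → E}
    (hF : ∀ i, AEStronglyMeasurable (F i) μ) (hs : ∑' i, ∫⁻ x, ‖F i x‖ₑ ∂μ ≠ ⊤) :
    (∀ i, Integrable (F i) μ) ∧ (∀ᵐ x ∂μ, Summable fun i => F i x) ∧
      Integrable (fun x => ∑' i, F i x) μ ∧
      HasSum (fun i => ∫ x, F i x ∂μ) (∫ x, ∑' i, F i x ∂μ) := by
  have hi : ∀ i, Integrable (F i) μ := fun i => ⟨hF i, ENNReal.lt_top_of_tsum_ne_top hs i⟩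
  have hfin : ∫⁻ x, ∑' i, ‖F i x‖ₑ ∂μ ≠ ⊤ := by
    rwa [lintegral_tsum fun i => (hF i).enorm]
  have hae : ∀ᵐ x ∂μ, Summable fun i => F i x := by
    filter_upwards [ae_lt_top' (AEMeasurable.tsum fun i => (hF i).enorm) hfin] with x hx
    refine Summable.of_norm ?_
    refine (ENNReal.summable_toReal hx.ne).congr fun i => ?_
    rw [toReal_enorm]
  refine ⟨hi, hae, ⟨?_, ?_⟩, hasSum_integral_of_summable_integral_norm hi ?_⟩
  · refine aestronglyMeasurable_of_tendsto_ae (Filter.atTop : Filter (Finset ι))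
      (f := fun s x => ∑ i ∈ s, F i x) (fun s => ?_) (hae.mono fun x hx => hx.hasSum)
    exact Finset.aestronglyMeasurable_fun_sum s fun i _ => hF i
  · refine lt_of_le_of_lt (lintegral_mono fun x => ?_) (lt_top_iff_ne_top.2 hfin)
    exact enorm_tsum_le_tsum_enorm
  · refine (ENNReal.summable_toReal hs).congr fun i => ?_
    rw [integral_norm_eq_lintegral_enorm (hF i)]

theorem summable_inv_wt_sq : Summable fun j : ℤ => (wt j ^ 2)⁻¹ := by
  have h1 : Summable fun j : ℤ => 1 / (j : ℝ) ^ 2 := Real.summable_one_div_int_pow.2 one_lt_two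
  refine Summable.of_norm_bounded_eventually h1 ?_
  rw [Filter.eventually_cofinite]
  refine (Set.finite_singleton (0 : ℤ)).subset fun j hj => ?_
  by_contra h0
  refine hj ?_
  have h2 : 0 < |(j : ℝ)| := abs_pos.2 (by exact_mod_cast h0)
  rw [Real.norm_of_nonneg (by positivity), ← sq_abs (j : ℝ), one_div]
  gcongr
  unfold wt
  linarith

/-- The `j`-th term of the series that defines the Green's function. -/
def greenTerm (k α : ℝ) (j : ℤ) (z : ℝ × ℝ) : ℂ :=
  Complex.I / (4 * Real.pi) * (betaJ k α j)⁻¹ * mode (alphaJ α j) (kerE (betaJ k α j)) z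

theorem green_eq_tsum (k α : ℝ) (z : ℝ × ℝ) : green k α z = ∑' j, greenTerm k α j z := by
  rw [green, ← tsum_mul_left]
  refine tsum_congr fun j => ?_
  rw [greenTerm, mode, kerE, ← Complex.exp_add]
  ring

theorem measurable_greenTerm (k α : ℝ) (j : ℤ) : Measurable (greenTerm k α j) := by
  unfold greenTerm mode kerE
  fun_prop

theorem enorm_greenTerm (k α : ℝ) (j : ℤ) (z : ℝ × ℝ) : ‖greenTerm k α j z‖ₑ =
    ‖Complex.I / (4 * Real.pi) * (betaJ k α j)⁻¹‖ₑ * ‖kerE (betaJ k α j) z.2‖ₑ := by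
  rw [greenTerm, enorm_mul, mode, enorm_mul (Complex.exp _), ← ofReal_norm (Complex.exp _),
    norm_exp_I_mul_mul,
    ENNReal.ofReal_one, one_mul]

/-- A bounded measurable function that vanishes outside a large square. -/
structure IsCutoff (ψ : ℝ × ℝ → ℝ) : Prop where
  meas : Measurable ψ
  bdd : ∃ M R : ℝ, 0 ≤ M ∧ ∀ x, ‖ψ x‖ₑ ≤ (Ioo (-R) R ×ˢ Ioo (-R) R).indicator
    (fun _ => ENNReal.ofReal M) x

/-- One factor `1 / wt j` comes from `β_j⁻¹`, the other from integrating the exponential decay in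
`x₂`. So the Green series is absolutely summable in `L¹_loc`, uniformly in the translation `y`,
although `x₂ = 0` offers no pointwise decay beyond `β_j⁻¹`. -/
theorem IsCutoff.exists_bound {ψ : ℝ × ℝ → ℝ} (h : IsCutoff ψ) {k : ℝ} (hk : 0 < k) (α : ℝ) :
    ∃ C : ℝ, 0 ≤ C ∧ ∀ j y, ∫⁻ x, ‖ψ x‖ₑ * ‖greenTerm k α j (x - y)‖ₑ ≤
      ENNReal.ofReal (C * (wt j ^ 2)⁻¹) := by
  obtain ⟨M, R, hM, hψ⟩ := h.bdd
  obtain ⟨C1, hC1, h1⟩ := exists_bound_inv_betaJ hk α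
  obtain ⟨C2, hC2, h2⟩ := exists_bound_kerE hk α
    (Measure.restrict_le_self (μ := (volume : Measure ℝ)) (s := Ioo (-R) R))
  set c : ℂ := Complex.I / (4 * Real.pi)
  refine ⟨M * (‖c‖ * C1) * (|R - -R| * C2), by positivity, fun j y => ?_⟩
  have hw := wt_pos j
  set S := Ioo (-R) R with hS
  have hb : ∀ x, ‖ψ x‖ₑ * ‖greenTerm k α j (x - y)‖ₑ ≤ (S ×ˢ S).indicator (fun x =>
      ENNReal.ofReal M * ENNReal.ofReal (‖c‖ * C1 / wt j) *
        ‖kerE (betaJ k α j) (x.2 - y.2)‖ₑ) x := by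
    intro x
    by_cases hx : x ∈ S ×ˢ S
    · have := hψ x
      rw [indicator_of_mem hx] at this ⊢
      rw [enorm_greenTerm, mul_assoc]
      refine mul_le_mul' this (mul_le_mul' ?_ le_rfl)
      rw [← ofReal_norm]
      refine ENNReal.ofReal_le_ofReal ?_
      rw [norm_mul, mul_div_assoc]
      refine mul_le_mul_of_nonneg_left ?_ (norm_nonneg _)
      rw [le_div_iff₀ hw]
      exact h1 j
    · have := hψ x
      rw [indicator_of_notMem hx] at this ⊢
      rw [nonpos_iff_eq_zero.1 this, zero_mul]
  have hm : Measurable fun t : ℝ => ‖kerE (betaJ k α j) (t - y.2)‖ₑ :=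
    ((continuous_kerE _).measurable.comp (by fun_prop)).enorm
  calc _ ≤ _ := lintegral_mono hb
    _ = ∫⁻ x in S ×ˢ S, ENNReal.ofReal M * ENNReal.ofReal (‖c‖ * C1 / wt j) *
        ‖kerE (betaJ k α j) (x.2 - y.2)‖ₑ :=
        lintegral_indicator (measurableSet_Ioo.prod measurableSet_Ioo) _
    _ = ENNReal.ofReal M * ENNReal.ofReal (‖c‖ * C1 / wt j) *
        (volume S * ∫⁻ t in S, ‖kerE (betaJ k α j) (t - y.2)‖ₑ) := by
        rw [lintegral_const_mul' _ _ (by finiteness), Measure.volume_eq_prod,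
          ← Measure.prod_restrict,
          lintegral_prod (fun x : ℝ × ℝ => ‖kerE (betaJ k α j) (x.2 - y.2)‖ₑ)
            (hm.comp measurable_snd).aemeasurable]
        simp [mul_comm]
    _ ≤ ENNReal.ofReal M * ENNReal.ofReal (‖c‖ * C1 / wt j) *
        (ENNReal.ofReal |R - -R| * ENNReal.ofReal (C2 / wt j)) := by
        refine mul_le_mul' le_rfl (mul_le_mul' ?_ (h2 j y.2))
        rw [Real.volume_Ioo]
        exact ENNReal.ofReal_le_ofReal (le_abs_self _)
    _ = _ := by
        rw [← ENNReal.ofReal_mul hM, ← ENNReal.ofReal_mul (abs_nonneg _),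
          ← ENNReal.ofReal_mul (by positivity)]
        congr 1
        field_simp

/-- Summing over `j` before integrating over `x` and `y` is legitimate because the `L¹` norms on the
product space are summable. Integrability of the whole double integrand comes along and makes Fubini
available. -/
theorem IsCutoff.series {ψ : ℝ × ℝ → ℝ} (h : IsCutoff ψ) {k : ℝ} (hk : 0 < k) (α : ℝ)
    {G : ℝ × ℝ → C2} (hG : Integrable G) (hGm : StronglyMeasurable G) :
    (∀ j, Integrable fun p : (ℝ × ℝ) × (ℝ × ℝ) => ψ p.1 • greenTerm k α j (p.1 - p.2) • G p.2) ∧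
    Integrable (fun p : (ℝ × ℝ) × (ℝ × ℝ) => ψ p.1 • green k α (p.1 - p.2) • G p.2) ∧
    HasSum (fun j => ∫ p : (ℝ × ℝ) × (ℝ × ℝ), ψ p.1 • greenTerm k α j (p.1 - p.2) • G p.2)
      (∫ p : (ℝ × ℝ) × (ℝ × ℝ), ψ p.1 • green k α (p.1 - p.2) • G p.2) := by
  obtain ⟨C, hC, hb⟩ := h.exists_bound hk α
  have hg : ∀ j, Measurable fun p : (ℝ × ℝ) × (ℝ × ℝ) => greenTerm k α j (p.1 - p.2) := fun j =>
    (measurable_greenTerm k α j).comp (by fun_prop)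
  have hm : ∀ j, StronglyMeasurable fun p : (ℝ × ℝ) × (ℝ × ℝ) =>
      ψ p.1 • greenTerm k α j (p.1 - p.2) • G p.2 := fun j =>
    (h.meas.comp measurable_fst).stronglyMeasurable.smul
      ((hg j).stronglyMeasurable.smul (hGm.comp_measurable measurable_snd))
  have hle : ∀ j, ∫⁻ p : (ℝ × ℝ) × (ℝ × ℝ), ‖ψ p.1 • greenTerm k α j (p.1 - p.2) • G p.2‖ₑ ≤
      ENNReal.ofReal (C * (wt j ^ 2)⁻¹) * ∫⁻ y, ‖G y‖ₑ := by
    intro j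
    rw [Measure.volume_eq_prod, lintegral_prod_symm' _ (hm j).enorm,
      ← lintegral_const_mul' _ _ ENNReal.ofReal_ne_top]
    refine lintegral_mono fun y => ?_
    simp only [enorm_smul, ← mul_assoc]
    have hm2 : Measurable fun x : ℝ × ℝ => ‖ψ x‖ₑ * ‖greenTerm k α j (x - y)‖ₑ :=
      h.meas.enorm.mul ((measurable_greenTerm k α j).comp (by fun_prop)).enorm
    rw [lintegral_mul_const _ hm2]
    exact mul_le_mul' (hb j y) le_rfl
  have hs : ∑' j, ∫⁻ p : (ℝ × ℝ) × (ℝ × ℝ), ‖ψ p.1 • greenTerm k α j (p.1 - p.2) • G p.2‖ₑ ≠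
      ⊤ := by
    refine ne_top_of_le_ne_top ?_ (ENNReal.tsum_le_tsum hle)
    rw [ENNReal.tsum_mul_right]
    exact ENNReal.mul_ne_top (summable_inv_wt_sq.mul_left C).tsum_ofReal_ne_top hG.2.ne
  obtain ⟨h1, h2, h3, h4⟩ :=
    integrable_tsum_of_lintegral (fun j => (hm j).aestronglyMeasurable) hs
  have he : (fun p : (ℝ × ℝ) × (ℝ × ℝ) => ∑' j, ψ p.1 • greenTerm k α j (p.1 - p.2) • G p.2)
      =ᵐ[volume] fun p => ψ p.1 • green k α (p.1 - p.2) • G p.2 := by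
    filter_upwards [h2] with p hp
    by_cases h0 : ψ p.1 = 0
    · simp [h0]
    by_cases h0' : G p.2 = 0
    · simp [h0']
    -- Away from the zeros of `ψ` and `G`, these factors can be divided out of the summable norms.
    have hsum : Summable fun j => greenTerm k α j (p.1 - p.2) := by
      have := hp.norm
      simp only [norm_smul, ← mul_assoc] at this
      rw [summable_mul_right_iff (norm_ne_zero_iff.2 h0'),
        summable_mul_left_iff (norm_ne_zero_iff.2 h0)] at this
      exact this.of_norm
    rw [green_eq_tsum, ← hsum.tsum_smul_const, (hsum.smul_const _).tsum_const_smul]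
  refine ⟨h1, h3.congr he, ?_⟩
  rwa [integral_congr_ae he] at h4

/-- The extension of a field on `D` by zero. -/
def extend (D : Set (ℝ × ℝ)) (g : L2v D) : ℝ × ℝ → C2 := D.indicator g

theorem isDensity_extend {D : Set (ℝ × ℝ)} {ρ : ℝ} (hD : MeasurableSet D) (hDρ : D ⊆ box ρ)
    (g : L2v D) (i : Fin 2) : IsDensity ρ fun x => extend D g x i where
  meas := (measurable_pi_apply i).comp ((PiLp.continuous_ofLp 2 _).measurable.comp
    ((Lp.stronglyMeasurable g).measurable.indicator hD))
  memLp := (EuclideanSpace.proj (𝕜 := ℂ) i).comp_memLp'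
    ((memLp_indicator_iff_restrict hD).2 (Lp.memLp g))
  supp := fun x hx => by
    rw [extend, indicator_of_notMem fun h => hx (hDρ h)]
    rfl

theorem stronglyMeasurable_extend {D : Set (ℝ × ℝ)} (hD : MeasurableSet D) (g : L2v D) :
    StronglyMeasurable (extend D g) := (Lp.stronglyMeasurable g).indicator hD

theorem integrable_extend {D : Set (ℝ × ℝ)} {ρ : ℝ} (hD : MeasurableSet D) (hDρ : D ⊆ box ρ)
    (g : L2v D) : Integrable (extend D g) := by
  have hf : IsFiniteMeasure ((volume : Measure (ℝ × ℝ)).restrict D) :=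
    ⟨by simpa using (measure_mono hDρ).trans_lt (volume_box_lt_top ρ)⟩
  exact (integrable_indicator_iff hD).2 ((Lp.memLp g).integrable (by norm_num))

theorem volPot_eq {D : Set (ℝ × ℝ)} (hD : MeasurableSet D) (k α : ℝ) (g : L2v D) (x : ℝ × ℝ) :
    volPot k α D g x = ∫ y, green k α (x - y) • extend D g y := by
  rw [volPot, ← integral_indicator hD]
  congr 1
  funext y
  by_cases hy : y ∈ D <;> simp [extend, hy]

/-- Cutoffs need not be continuous: indicators of compact sets give local integrability of the
potential, while derivatives of test functions give the mode expansion of its weak divergence. -/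
theorem IsCutoff.volPot {D : Set (ℝ × ℝ)} {ψ : ℝ × ℝ → ℝ} (h : IsCutoff ψ) {k : ℝ} (hk : 0 < k)
    (α : ℝ) {ρ : ℝ}
    (hD : MeasurableSet D) (hDρ : D ⊆ box ρ) (g : L2v D) :
    Integrable (fun x => ψ x • volPot k α D g x) ∧
    ∀ i, HasSum (fun j => ∫ x, ψ x • (Complex.I / (4 * Real.pi) * (betaJ k α j)⁻¹ *
        mode (alphaJ α j) (lineConv (kerE (betaJ k α j))
          (coef α (fun y => extend D g y i) j)) x))
      (∫ x, ψ x • volPot k α D g x i) := by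
  obtain ⟨h1, h2, h3⟩ := h.series hk α (integrable_extend hD hDρ g) (stronglyMeasurable_extend hD g)
  have hi : Integrable (fun x => ψ x • Grating.volPot k α D g x) := by
    have := h2
    rw [Measure.volume_eq_prod] at this
    simpa only [integral_smul, ← volPot_eq hD] using this.integral_prod_left
  refine ⟨hi, fun i => ?_⟩
  have h4 := h3.mapL (EuclideanSpace.proj (𝕜 := ℂ) i)
  have e1 : EuclideanSpace.proj (𝕜 := ℂ) i (∫ p : (ℝ × ℝ) × (ℝ × ℝ),
      ψ p.1 • green k α (p.1 - p.2) • extend D g p.2) = ∫ x, ψ x • Grating.volPot k α D g x i := by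
    have e2 := (EuclideanSpace.proj (𝕜 := ℂ) i).integral_comp_comm hi
    rw [Measure.volume_eq_prod] at h2 ⊢
    rw [integral_prod _ h2]
    simp only [integral_smul, ← volPot_eq hD]
    exact e2.symm
  have e3 : ∀ j, EuclideanSpace.proj (𝕜 := ℂ) i (∫ p : (ℝ × ℝ) × (ℝ × ℝ),
      ψ p.1 • greenTerm k α j (p.1 - p.2) • extend D g p.2) =
      ∫ x, ψ x • (Complex.I / (4 * Real.pi) * (betaJ k α j)⁻¹ *
        mode (alphaJ α j) (lineConv (kerE (betaJ k α j))
          (coef α (fun y => extend D g y i) j)) x) := by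
    intro j
    have e4 := (EuclideanSpace.proj (𝕜 := ℂ) i).integrable_comp (h1 j)
    rw [← (EuclideanSpace.proj (𝕜 := ℂ) i).integral_comp_comm (h1 j)]
    rw [Measure.volume_eq_prod] at e4 ⊢
    rw [integral_prod _ e4]
    refine integral_congr_ae (.of_forall fun x => ?_)
    simp only [← (isDensity_extend hD hDρ g i).integral_mode_sub α j
      (continuous_kerE (betaJ k α j)).measurable (norm_kerE_le_one (betaJ_im_nonneg k α j)),
      ← integral_const_mul, ← integral_smul]
    refine integral_congr_ae (.of_forall fun y => ?_)
    simp [greenTerm, mul_assoc]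
  rw [e1] at h4
  exact h4.congr_fun fun j => (e3 j).symm

/-! ### Existence of `L_k g` -/

theorem mode_quasiPeriodic (α : ℝ) (j : ℤ) (u : ℝ → ℂ) (x : ℝ × ℝ) :
    mode (alphaJ α j) u (x.1 + 2 * Real.pi, x.2) =
      Complex.exp (2 * Real.pi * Complex.I * α) * mode (alphaJ α j) u x := by
  rw [mode, mode, ← mul_assoc, ← Complex.exp_add]
  congr 1
  rw [Complex.exp_eq_exp_iff_exists_int]
  refine ⟨j, ?_⟩
  unfold alphaJ
  push_cast
  ring

theorem ae_comp_shift {p : ℝ × ℝ → Prop} (h : ∀ᵐ x : ℝ × ℝ, p x) :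
    ∀ᵐ x : ℝ × ℝ, p (x.1 + 2 * Real.pi, x.2) := by
  have hm : MeasurePreserving (fun x : ℝ × ℝ => x + (2 * Real.pi, 0)) volume volume :=
    measurePreserving_add_right volume (2 * Real.pi, 0)
  filter_upwards [hm.quasiMeasurePreserving.ae h] with x hx
  have e : (x.1 + 2 * Real.pi, x.2) = x + (2 * Real.pi, 0) := Prod.ext rfl (add_zero _).symm
  rwa [e]

/-- Each mode is quasi-periodic, and a subsequence of the partial sums converges almost everywhere.
Although `planeMeas` is not translation invariant, its null sets are Lebesgue null, so the
convergence also holds at almost every shifted point and the limits can be compared. -/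
theorem isQuasiPeriodic_tsum_mode (α : ℝ) {u : ℤ → ℝ → ℂ} (hu : SqSum u) :
    IsQuasiPeriodic α (∑' j, (memLp_mode (hu.memLp j) (alphaJ α j)).toLp _ :
      Lp ℂ 2 planeMeas) := by
  set F := fun j => (memLp_mode (hu.memLp j) (alphaJ α j)).toLp _ with hF
  obtain ⟨e⟩ : Nonempty (ℕ ≃ ℤ) := ⟨Equiv.intEquivNat.symm⟩
  have hs : HasSum (F ∘ e) (∑' j, F j) :=
    e.hasSum_iff.2 (summable_mode α hu.memLp hu.summable).hasSum
  obtain ⟨ns, -, hns⟩ := (tendstoInMeasure_of_tendsto_Lp hs.tendsto_sum_nat).exists_seq_tendsto_ae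
  have h1 : ∀ᵐ x : ℝ × ℝ, ∀ n, (∑ i ∈ Finset.range n, F (e i) : Lp ℂ 2 planeMeas) x =
      ∑ i ∈ Finset.range n, mode (alphaJ α (e i)) (u (e i)) x := by
    refine ae_volume_of_ae_planeMeas (ae_all_iff.2 fun n => ?_)
    have h2 : ∀ᵐ x ∂planeMeas, ∀ i, F (e i) x = mode (alphaJ α (e i)) (u (e i)) x :=
      ae_all_iff.2 fun i => MemLp.coeFn_toLp _
    filter_upwards [h2, Lp.coeFn_finsetSum (Finset.range n) fun i => F (e i)] with x hx hx'
    rw [hx', Finset.sum_apply]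
    exact Finset.sum_congr rfl fun i _ => hx i
  have h3 := ae_volume_of_ae_planeMeas hns
  filter_upwards [h1, h3, ae_comp_shift h1, ae_comp_shift h3] with x a1 a2 a3 a4
  refine tendsto_nhds_unique a4 ((a2.const_mul _).congr fun n => ?_)
  simp only [Function.comp_apply, a1, a3, mode_quasiPeriodic, Finset.mul_sum]

theorem hasSum_integral_smul_mode (α : ℝ) {u : ℤ → ℝ → ℂ} (hu : SqSum u) {ψ : ℝ × ℝ → ℝ}
    (hψ : Continuous ψ) (hc : HasCompactSupport ψ) :
    HasSum (fun j => ∫ x, ψ x • mode (alphaJ α j) (u j) x)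
      (∫ x, ψ x • (∑' j, (memLp_mode (hu.memLp j) (alphaJ α j)).toLp _ : Lp ℂ 2 planeMeas) x) := by
  obtain ⟨T, hT⟩ := exists_pairing hψ hc
  have := (summable_mode α hu.memLp hu.summable).hasSum.mapL T
  rw [hT] at this
  refine this.congr_fun fun j => ?_
  rw [hT]
  refine integral_congr_ae ?_
  filter_upwards [ae_volume_of_ae_planeMeas
    (memLp_mode (hu.memLp j) (alphaJ α j)).coeFn_toLp] with x hx
  rw [hx]

/-- The three series with coefficients `u_j`, `iα_j u_j` and `v_j` converge in `L²(planeMeas)`.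
Pairing with test functions is continuous, so the weak derivative identities of the single modes
pass to the sums. -/
theorem exists_isH1Loc_of_modes (α : ℝ) {u v : ℤ → ℝ → ℂ} (hu : SqSum u)
    (hu1 : SqSum fun j t => Complex.I * alphaJ α j * u j t) (hv : SqSum v)
    (huv : ∀ j, HasWeakDeriv (u j) (v j)) :
    ∃ U P, IsH1Loc U P ∧ IsQuasiPeriodic α U ∧ ∀ ψ : ℝ × ℝ → ℝ, Continuous ψ →
      HasCompactSupport ψ →
      HasSum (fun j => ∫ x, ψ x • mode (alphaJ α j) (u j) x) (∫ x, ψ x • U x) := by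
  set U : Lp ℂ 2 planeMeas := ∑' j, (memLp_mode (hu.memLp j) (alphaJ α j)).toLp _
  set P1 : Lp ℂ 2 planeMeas := ∑' j, (memLp_mode (hu1.memLp j) (alphaJ α j)).toLp _
  set P2 : Lp ℂ 2 planeMeas := ∑' j, (memLp_mode (hv.memLp j) (alphaJ α j)).toLp _
  refine ⟨U, fun x => !₂[P1 x, P2 x], ⟨MemLp.isL2Loc (Lp.memLp U), MemLp.isL2Loc ?_, ?_, ?_⟩,
    isQuasiPeriodic_tsum_mode α hu, fun ψ hψ hc => hasSum_integral_smul_mode α hu hψ hc⟩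
  · refine MemLp.of_eval_piLp fun i => ?_
    fin_cases i
    · simpa using Lp.memLp P1
    · simpa using Lp.memLp P2
  · intro φ hφ
    have h1 := hasSum_integral_smul_mode α hu hφ.continuous_d1 hφ.compact_d1
    have h2 := (hasSum_integral_smul_mode α hu1 hφ.smooth.continuous hφ.compact).neg
    refine h1.unique (h2.congr_fun fun j => ?_)
    rw [integral_d1_mode hφ (hu.memLp j)]
    congr 2
    funext x
    simp only [mode]
    congr 1
    ring
  · intro φ hφ
    have h1 := hasSum_integral_smul_mode α hu hφ.continuous_d2 hφ.compact_d2
    have h2 := (hasSum_integral_smul_mode α hv hφ.smooth.continuous hφ.compact).neg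
    refine h1.unique (h2.congr_fun fun j => ?_)
    rw [integral_d2_mode hφ (hu.memLp j) (hv.memLp j) (huv j)]

theorem enorm_le_indicator {ψ : ℝ × ℝ → ℝ} {K : Set (ℝ × ℝ)} (hK : IsCompact K)
    (h0 : ∀ x ∉ K, ψ x = 0) {M : ℝ} (hM : ∀ x, ‖ψ x‖ ≤ M) (hM0 : 0 ≤ M) :
    ∃ M R : ℝ, 0 ≤ M ∧ ∀ x, ‖ψ x‖ₑ ≤ (Ioo (-R) R ×ˢ Ioo (-R) R).indicator
      (fun _ => ENNReal.ofReal M) x := by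
  obtain ⟨r, hr⟩ := hK.isBounded.subset_ball 0
  refine ⟨M, r, hM0, fun x => ?_⟩
  by_cases hx : x ∈ K
  · have h := hr hx
    rw [mem_ball_zero_iff, Prod.norm_def, max_lt_iff, Real.norm_eq_abs, Real.norm_eq_abs,
      abs_lt, abs_lt] at h
    rw [indicator_of_mem (show x ∈ Ioo (-r) r ×ˢ Ioo (-r) r from h), ← ofReal_norm]
    exact ENNReal.ofReal_le_ofReal (hM x)
  · rw [h0 x hx, enorm_zero]
    exact bot_le

theorem IsCutoff.of_continuous {ψ : ℝ × ℝ → ℝ} (hψ : Continuous ψ) (hc : HasCompactSupport ψ) :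
    IsCutoff ψ := by
  obtain ⟨M, hM⟩ := hψ.bounded_above_of_compact_support hc
  exact ⟨hψ.measurable, enorm_le_indicator hc
    (fun x hx => image_eq_zero_of_notMem_tsupport hx) hM ((norm_nonneg _).trans (hM 0))⟩

theorem IsCutoff.of_isCompact {K : Set (ℝ × ℝ)} (hK : IsCompact K) :
    IsCutoff (K.indicator fun _ => 1) := by
  refine ⟨measurable_const.indicator hK.measurableSet, enorm_le_indicator (M := 1) hK
    (fun x hx => indicator_of_notMem hx _) (fun x => ?_) zero_le_one⟩
  by_cases hx : x ∈ K <;> simp [hx]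

theorem locallyIntegrable_volPot {D : Set (ℝ × ℝ)} {k : ℝ} (hk : 0 < k) (α : ℝ) {ρ : ℝ}
    (hD : MeasurableSet D) (hDρ : D ⊆ box ρ) (g : L2v D) :
    LocallyIntegrable (volPot k α D g) := by
  rw [locallyIntegrable_iff]
  intro K hK
  have h := ((IsCutoff.of_isCompact hK).volPot hk α hD hDρ g).1
  rw [← integrable_indicator_iff hK.measurableSet]
  refine h.congr (.of_forall fun x => ?_)
  by_cases hx : x ∈ K <;> simp [hx]

theorem norm_green_coeff_le : ‖Complex.I / (4 * (Real.pi : ℂ))‖ ≤ 1 := by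
  have := Real.pi_gt_three
  rw [norm_div, Complex.norm_I, norm_mul, Complex.norm_real, Real.norm_of_nonneg (by linarith)]
  rw [div_le_one (by simp; linarith)]
  simp
  linarith

theorem IsTest.mono {D E : Set (ℝ × ℝ)} {φ : ℝ × ℝ → ℝ} (h : IsTest D φ) (hDE : D ⊆ E) :
    IsTest E φ := ⟨h.smooth, h.compact, h.supp.trans hDE⟩

theorem IsTest.eq_zero {D : Set (ℝ × ℝ)} {φ : ℝ × ℝ → ℝ} (h : IsTest D φ) {x : ℝ × ℝ}
    (hx : x ∉ D) : φ x = 0 ∧ d1 φ x = 0 ∧ d2 φ x = 0 := by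
  have h1 : x ∉ tsupport φ := fun h' => hx (h.supp h')
  have h2 : fderiv ℝ φ x = 0 :=
    image_eq_zero_of_notMem_tsupport fun h' => h1 (tsupport_fderiv_subset ℝ h')
  exact ⟨image_eq_zero_of_notMem_tsupport h1, by simp [d1, h2], by simp [d2, h2]⟩

/-- The divergence of the volume potential, as a function on the plane. -/
theorem exists_div_volPot {k α ρ : ℝ} (hk : 0 < k) (hres : ∀ j : ℤ, k ^ 2 ≠ alphaJ α j ^ 2)
    {D : Set (ℝ × ℝ)} (hD : MeasurableSet D) (hDρ : D ⊆ box ρ) (g : L2v D) :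
    ∃ U P, IsH1Loc U P ∧ IsQuasiPeriodic α U ∧ ∀ φ, IsTest univ φ →
      ∫ x, φ x • U x = -∫ x, (d1 φ x • volPot k α D g x 0 + d2 φ x • volPot k α D g x 1) := by
  set c : ℂ := Complex.I / (4 * Real.pi) with hc
  set β := betaJ k α with hβ
  have hβ0 : ∀ j, β j ≠ 0 := betaJ_ne_zero hres
  have hβi : ∀ j, 0 ≤ (β j).im := betaJ_im_nonneg k α
  have hγ := isDensity_extend hD hDρ g
  set h : Fin 2 → ℤ → ℝ → ℂ := fun i => coef α fun x => extend D g x i with hh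
  have hi : ∀ i j, Integrable (h i j) := fun i j => (hγ i).integrable_coef α j
  have hm : ∀ i j, Measurable (h i j) := fun i j => measurable_coef α (hγ i).meas j
  have hS1 : ∀ j t, ‖kerS (β j) t‖ ≤ 1 := fun j t =>
    (norm_kerS _ t).trans_le (norm_kerE_le_one (hβi j) t)
  have hE : ∀ i, SqSum fun j t => wt j * lineConv (kerE (β j)) (h i j) t := fun i =>
    SqSum.lineConv hk α ρ (hm i) (hi i) (fun j => (hγ i).coef_eq_zero α j)
      ((hγ i).tsum_coef_ne_top α) (fun j => (continuous_kerE _).measurable) fun _ _ => rfl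
  have hS : ∀ i, SqSum fun j t => wt j * lineConv (kerS (β j)) (h i j) t := fun i =>
    SqSum.lineConv hk α ρ (hm i) (hi i) (fun j => (hγ i).coef_eq_zero α j)
      ((hγ i).tsum_coef_ne_top α) (fun j => measurable_kerS _) fun _ _ => norm_kerS _ _
  have hH : ∀ i, SqSum (h i) := fun i => SqSum.of_volume (hm i) ((hγ i).tsum_coef_ne_top α)
  -- The `j`-th coefficient of `∂₁(V g₀) + ∂₂(V g₁)`, obtained by formal differentiation; `v` is its
  -- derivative in `x₂`.
  set u : ℤ → ℝ → ℂ := fun j t => c * (β j)⁻¹ * (Complex.I * alphaJ α j) *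
    lineConv (kerE (β j)) (h 0 j) t + c * (β j)⁻¹ * (Complex.I * β j) *
    lineConv (kerS (β j)) (h 1 j) t with hu
  set v : ℤ → ℝ → ℂ := fun j t => c * (β j)⁻¹ * (Complex.I * alphaJ α j) *
    (Complex.I * β j * lineConv (kerS (β j)) (h 0 j) t) + c * (β j)⁻¹ * (Complex.I * β j) *
    (2 * h 1 j t + Complex.I * β j * lineConv (kerE (β j)) (h 1 j) t) with hv
  obtain ⟨C, hC, hC'⟩ := exists_bound_inv_betaJ hk α
  have hw : ∀ j, (wt j : ℂ) ≠ 0 := fun j => by exact_mod_cast (wt_pos j).ne'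
  have hc1 : ‖c‖ ≤ 1 := norm_green_coeff_le
  have hwn : ∀ j, ‖(wt j : ℂ)‖ = wt j := fun j => by
    rw [Complex.norm_real, Real.norm_of_nonneg (wt_pos j).le]
  have hαn : ∀ j, ‖(alphaJ α j : ℂ)‖ ≤ (1 + |α|) * wt j := fun j => by
    rw [Complex.norm_real]; exact abs_alphaJ_le α j
  have hβn : ∀ j, ‖β j‖ ≤ (k + 1 + |α|) * wt j := norm_betaJ_le hk α
  have hβαn : ∀ j, ‖(β j)⁻¹‖ * ‖(alphaJ α j : ℂ)‖ ≤ C * (1 + |α|) := fun j => by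
    calc _ ≤ ‖(β j)⁻¹‖ * ((1 + |α|) * wt j) := by gcongr; exact hαn j
      _ = (‖(β j)⁻¹‖ * wt j) * (1 + |α|) := by ring
      _ ≤ _ := by gcongr; exact hC' j
  -- The factor `β_j⁻¹ α_j` is bounded and `β_j⁻¹ β_j` is one, so `u` keeps the whole gain `wt j` of
  -- the convolutions. This controls both `u` and `iα_j u`.
  have hwu : SqSum fun j t => wt j * u j t := by
    have h1 := ((hE 0).mul (c := fun j => c * (β j)⁻¹ * (Complex.I * alphaJ α j))
      (C := 1 * (C * (1 + |α|))) fun j => by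
        rw [norm_mul, norm_mul, norm_mul, Complex.norm_I, one_mul, mul_assoc]
        exact mul_le_mul hc1 (hβαn j) (by positivity) zero_le_one).add
      ((hS 1).mul (c := fun j => c * (β j)⁻¹ * (Complex.I * β j)) (C := 1) fun j => by
        have e : c * (β j)⁻¹ * (Complex.I * β j) = c * Complex.I := by
          have := hβ0 j
          field_simp
        rwa [e, norm_mul, Complex.norm_I, mul_one])
    refine cast (congrArg SqSum ?_) h1
    funext j t
    simp only [hu]
    ring
  have husum : SqSum u := by
    refine cast (congrArg SqSum ?_) (hwu.mul (c := fun j => (wt j : ℂ)⁻¹) (C := 1) fun j => ?_)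
    · funext j t
      exact inv_mul_cancel_left₀ (hw j) _
    · rw [norm_inv, hwn]
      exact inv_le_one_of_one_le₀ (one_le_wt j)
  have hu1 : SqSum fun j t => Complex.I * alphaJ α j * u j t := by
    refine cast (congrArg SqSum ?_) (hwu.mul (c := fun j => Complex.I * alphaJ α j / wt j)
      (C := 1 + |α|) fun j => ?_)
    · funext j t
      rw [← mul_assoc, div_mul_cancel₀ _ (hw j)]
    · rw [norm_div, norm_mul, Complex.norm_I, one_mul, hwn, div_le_iff₀ (wt_pos j)]
      exact hαn j
  -- After cancelling `β_j`, the coefficients of the two convolutions are `-cα_j` and `-cβ_j`. Both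
  -- are `O(wt j)`, which the convolutions compensate. The delta term `2ic h₁` is square summable by
  -- Parseval.
  have hvsum : SqSum v := by
    have h1 := ((hS 0).mul (c := fun j => -(c * alphaJ α j / wt j)) (C := 1 + |α|) fun j => by
        rw [norm_neg, norm_div, norm_mul, hwn, div_le_iff₀ (wt_pos j)]
        exact (mul_le_of_le_one_left (norm_nonneg _) hc1).trans (hαn j)).add
      (((hH 1).mul (c := fun _ => 2 * c * Complex.I) (C := _) fun j => le_rfl).add
      ((hE 1).mul (c := fun j => -(c * β j / wt j)) (C := k + 1 + |α|) fun j => by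
        rw [norm_neg, norm_div, norm_mul, hwn, div_le_iff₀ (wt_pos j)]
        exact (mul_le_of_le_one_left (norm_nonneg _) hc1).trans (hβn j)))
    refine cast (congrArg SqSum ?_) h1
    funext j t
    have := hβ0 j
    have := hw j
    simp only [hv]
    field_simp
    ring_nf
    simp only [Complex.I_sq]
    ring
  have hloc : ∀ {K : ℝ → ℂ}, Measurable K → (∀ t, ‖K t‖ ≤ 1) → ∀ i j,
      LocallyIntegrable (lineConv K (h i j)) := fun hK hK1 i j =>
    locallyIntegrable_lineConv hK hK1 (hi i j)
  have hlm : ∀ (a : ℂ) {f : ℝ → ℂ}, LocallyIntegrable f → LocallyIntegrable fun t => a * f t :=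
    fun a _ hf => hf.smul a
  have huv : ∀ j, HasWeakDeriv (u j) (v j) := by
    intro j
    have lE := fun i => hloc (continuous_kerE (β j)).measurable (norm_kerE_le_one (hβi j)) i j
    have lS := fun i => hloc (measurable_kerS (β j)) (hS1 j) i j
    refine ((hasWeakDeriv_lineConv_kerE (hβi j) (hi 0 j)).const_mul _).add
      ((hasWeakDeriv_lineConv_kerS (hβi j) (hi 1 j)).const_mul _) ?_ ?_ ?_ ?_
    · exact hlm _ (lE 0)
    · exact hlm _ (hlm _ (lS 0))
    · exact hlm _ (lS 1)
    · exact hlm _ ((hlm 2 (hi 1 j).locallyIntegrable).add (hlm (Complex.I * β j) (lE 1)))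
  obtain ⟨U, P, hU, hq, hUs⟩ := exists_isH1Loc_of_modes α husum hu1 hvsum huv
  refine ⟨U, P, hU, hq, fun φ hφ => ?_⟩
  obtain ⟨i0, s0⟩ := (IsCutoff.of_continuous hφ.continuous_d1 hφ.compact_d1).volPot hk α hD hDρ g
  obtain ⟨i1, s1⟩ := (IsCutoff.of_continuous hφ.continuous_d2 hφ.compact_d2).volPot hk α hD hDρ g
  have j0 : Integrable fun x => d1 φ x • volPot k α D g x 0 :=
    (EuclideanSpace.proj (𝕜 := ℂ) (0 : Fin 2)).integrable_comp i0
  have j1 : Integrable fun x => d2 φ x • volPot k α D g x 1 :=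
    (EuclideanSpace.proj (𝕜 := ℂ) (1 : Fin 2)).integrable_comp i1
  rw [integral_add j0 j1]
  refine (hUs φ hφ.smooth.continuous hφ.compact).unique
    (((s0 0).add (s1 1)).neg.congr_fun fun j => ?_)
  have m0 := (memLp_lineConv (continuous_kerE (β j)).measurable (norm_kerE_le_one (hβi j)) (hi 0 j))
  have m1 := (memLp_lineConv (continuous_kerE (β j)).measurable (norm_kerE_le_one (hβi j)) (hi 1 j))
  have m2 := (memLp_lineConv (measurable_kerS (β j)) (hS1 j) (hi 1 j))
  have hmul : ∀ (ψ : ℝ × ℝ → ℝ) (a : ℂ) (f : ℝ × ℝ → ℂ),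
      ∫ x, ψ x • (a * f x) = a * ∫ x, ψ x • f x := fun ψ a f => by
    simp only [← mul_smul_comm, integral_const_mul]
  change _ = -((∫ x, d1 φ x • (c * (β j)⁻¹ * mode (alphaJ α j)
      (lineConv (kerE (β j)) (h 0 j)) x)) + ∫ x, d2 φ x • (c * (β j)⁻¹ * mode (alphaJ α j)
      (lineConv (kerE (β j)) (h 1 j)) x))
  -- Integration by parts mode by mode moves the derivatives from `φ` onto the modes, which
  -- reproduces `u j`.
  rw [hmul, hmul, integral_d1_mode hφ m0, integral_d2_mode hφ m1
    (m2.const_mul _) (hasWeakDeriv_lineConv_kerE (hβi j) (hi 1 j))]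
  have k0 := integrable_test hφ.smooth.continuous hφ.compact
    (MemLp.isL2Loc ((memLp_mode m0 (alphaJ α j)).const_mul (Complex.I * alphaJ α j)))
  have k1 := integrable_test hφ.smooth.continuous hφ.compact
    (MemLp.isL2Loc (memLp_mode (m2.const_mul (Complex.I * β j)) (alphaJ α j)))
  rw [← mul_add, ← neg_add, ← mul_neg, neg_neg, ← integral_add k0 k1, ← integral_const_mul]
  congr 1
  funext x
  simp only [mode, hu, Complex.real_smul]
  ring

theorem exists_isLk {k α ρ : ℝ} (hk : 0 < k) (hres : ∀ j : ℤ, k ^ 2 ≠ alphaJ α j ^ 2)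
    {D : Set (ℝ × ℝ)} (hD : IsOpen D) (hDρ : D ⊆ box ρ) (g : L2v D) :
    ∃ w : H1 D α, IsLk k α D g w := by
  obtain ⟨U, P, hU, hq, h⟩ := exists_div_volPot hk hres hD.measurableSet hDρ g
  have hK : IsCompact (Icc (-Real.pi) Real.pi ×ˢ Icc (-ρ) ρ) := isCompact_Icc.prod isCompact_Icc
  have hDK : D ⊆ Icc (-Real.pi) Real.pi ×ˢ Icc (-ρ) ρ :=
    hDρ.trans (prod_mono Ioo_subset_Icc_self Ioo_subset_Icc_self)
  have hU2 : MemLp U 2 (volume.restrict D) :=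
    (hU.fn _ hK).mono_measure (Measure.restrict_mono hDK le_rfl)
  have hP2 : MemLp P 2 (volume.restrict D) :=
    (hU.grad _ hK).mono_measure (Measure.restrict_mono hDK le_rfl)
  refine ⟨⟨WithLp.toLp 2 (hU2.toLp U, hP2.toLp P), U, P, hU, hq, hU2.coeFn_toLp,
    hP2.coeFn_toLp⟩, ?_, fun φ hφ => ?_⟩
  · exact (locallyIntegrable_volPot hk α hD.measurableSet hDρ g).locallyIntegrableOn _
  · have h1 := h φ (hφ.mono (subset_univ D))
    have e1 : ∫ x in D, φ x • U x = ∫ x, φ x • U x :=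
      setIntegral_eq_integral_of_forall_compl_eq_zero fun x hx => by
        rw [(hφ.eq_zero hx).1, zero_smul]
    have e2 : ∫ x in D, (d1 φ x • volPot k α D g x 0 + d2 φ x • volPot k α D g x 1) =
        ∫ x, (d1 φ x • volPot k α D g x 0 + d2 φ x • volPot k α D g x 1) :=
      setIntegral_eq_integral_of_forall_compl_eq_zero fun x hx => by
        rw [(hφ.eq_zero hx).2.1, (hφ.eq_zero hx).2.2, zero_smul, zero_smul, add_zero]
    rw [e2, ← h1, ← e1]
    refine integral_congr_ae ?_
    filter_upwards [hU2.coeFn_toLp] with x hx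
    rw [← hx]
    rfl

/-! ### Uniqueness of `L_k g` -/

theorem ae_eq_zero_of_integral_isTest_smul_eq_zero {D : Set (ℝ × ℝ)} (hD : IsOpen D) {f : ℝ × ℝ → ℂ}
    (hf : IntegrableOn f D) (h : ∀ φ, IsTest D φ → ∫ x in D, φ x • f x = 0) :
    ∀ᵐ x ∂(volume.restrict D), f x = 0 := by
  rw [ae_restrict_iff' hD.measurableSet]
  refine hD.ae_eq_zero_of_integral_contDiff_smul_eq_zero hf.locallyIntegrableOn
    fun φ h1 h2 h3 => ?_
  have hφ : IsTest D φ := ⟨h1, h2, h3⟩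
  rw [← h φ hφ]
  refine (setIntegral_eq_integral_of_forall_compl_eq_zero fun x hx => ?_).symm
  rw [(hφ.eq_zero hx).1, zero_smul]

/-- Test functions supported in the open set `D` see only the values of `U` in `D`. This is needed
because elements of `H1 D α` are pairs of a function and a gradient. -/
theorem IsH1Loc.grad_eq_zero {U : ℝ × ℝ → ℂ} {P : ℝ × ℝ → C2} (h : IsH1Loc U P)
    {D : Set (ℝ × ℝ)} (hD : IsOpen D) (hU : ∀ᵐ x ∂(volume.restrict D), U x = 0)
    (hP : IntegrableOn P D) : ∀ᵐ x ∂(volume.restrict D), P x = 0 := by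
  have key : ∀ i : Fin 2, ∀ᵐ x ∂(volume.restrict D), P x i = 0 := by
    intro i
    refine ae_eq_zero_of_integral_isTest_smul_eq_zero hD
      ((EuclideanSpace.proj (𝕜 := ℂ) i).integrable_comp hP)
      fun φ hφ => ?_
    have e1 : ∫ x in D, φ x • P x i = ∫ x, φ x • P x i :=
      setIntegral_eq_integral_of_forall_compl_eq_zero fun x hx => by
        rw [(hφ.eq_zero hx).1, zero_smul]
    have hU' := (ae_restrict_iff' hD.measurableSet).1 hU
    rw [e1]
    have hφ' := hφ.mono (subset_univ D)
    fin_cases i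
    · refine neg_eq_zero.1 ((h.weak1 φ hφ').symm.trans (integral_eq_zero_of_ae ?_))
      filter_upwards [hU'] with x hx
      by_cases hxD : x ∈ D
      · simp [hx hxD]
      · simp [(hφ.eq_zero hxD).2.1]
    · refine neg_eq_zero.1 ((h.weak2 φ hφ').symm.trans (integral_eq_zero_of_ae ?_))
      filter_upwards [hU'] with x hx
      by_cases hxD : x ∈ D
      · simp [hx hxD]
      · simp [(hφ.eq_zero hxD).2.2]
  filter_upwards [key 0, key 1] with x h0 h1
  ext i
  fin_cases i
  · exact h0
  · exact h1

theorem integrableOn_Lp {E : Type*} [NormedAddCommGroup E] {D : Set (ℝ × ℝ)}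
    (hD : volume D < ⊤) (f : Lp E 2 ((volume : Measure (ℝ × ℝ)).restrict D)) : IntegrableOn f D :=
  have : IsFiniteMeasure ((volume : Measure (ℝ × ℝ)).restrict D) := ⟨by simpa using hD⟩
  (Lp.memLp f).integrable (by norm_num)

/-- An element of `H¹_α(D)` whose function vanishes is zero. -/
theorem H1.eq_zero_of_fn {D : Set (ℝ × ℝ)} (hD : IsOpen D) (hfin : volume D < ⊤) {α : ℝ}
    (w : H1 D α) (hw : w.fn = 0) : w = 0 := by
  obtain ⟨U, P, h1, -, h3, h4⟩ := w.2
  have hU : ∀ᵐ x ∂(volume.restrict D), U x = 0 := by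
    filter_upwards [h3, Lp.coeFn_zero ℂ 2 (volume.restrict D)] with x hx h0
    rw [← hx, show w.1.fst = 0 from hw, h0, Pi.zero_apply]
  have hP : IntegrableOn P D := (integrableOn_Lp hfin w.1.snd).congr h4
  have hP0 := h1.grad_eq_zero hD hU hP
  have hg : w.1.snd = 0 := by
    apply Lp.ext
    filter_upwards [h4, hP0, Lp.coeFn_zero C2 2 (volume.restrict D)] with x a b c
    rw [a, b, c, Pi.zero_apply]
  apply Subtype.ext
  exact (WithLp.ofLp_injective 2) (Prod.ext hw hg)

theorem integrable_test_smul {D : Set (ℝ × ℝ)} {φ : ℝ × ℝ → ℝ} (hφ : IsTest D φ) {f : ℝ × ℝ → ℂ}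
    (hf : IntegrableOn f D) : IntegrableOn (fun x => φ x • f x) D := by
  obtain ⟨M, hM⟩ := hφ.smooth.continuous.bounded_above_of_compact_support hφ.compact
  exact hf.bdd_smul M hφ.smooth.continuous.aestronglyMeasurable (.of_forall hM)

theorem IsLk.unique {k α : ℝ} {D : Set (ℝ × ℝ)} (hD : IsOpen D) (hfin : volume D < ⊤) {g : L2v D}
    {w w' : H1 D α} (h : IsLk k α D g w) (h' : IsLk k α D g w') : w = w' := by
  rw [← sub_eq_zero]
  refine H1.eq_zero_of_fn hD hfin _ ?_
  change w.fn - w'.fn = 0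
  rw [sub_eq_zero]
  apply Lp.ext
  have i1 := integrableOn_Lp hfin w.fn
  have i2 := integrableOn_Lp hfin w'.fn
  have := ae_eq_zero_of_integral_isTest_smul_eq_zero hD (f := fun x => w.fn x - w'.fn x) (i1.sub i2)
    fun φ hφ => by
      simp only [smul_sub]
      rw [integral_sub (integrable_test_smul hφ i1) (integrable_test_smul hφ i2),
        h.weakDiv φ hφ, h'.weakDiv φ hφ, sub_self]
  filter_upwards [this] with x hx
  exact sub_eq_zero.1 hx

/-! ### The weighted space -/

theorem act_mul (A B : Matrix (Fin 2) (Fin 2) ℂ) (ξ : C2) : act (A * B) ξ = act A (act B ξ) := by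
  simp [act, map_mul]

theorem act_one (ξ : C2) : act 1 ξ = ξ := by
  simp [act]

theorem inner_act_left {A : Matrix (Fin 2) (Fin 2) ℂ} (hA : IsSelfAdjoint A) (ξ η : C2) :
    inner ℂ (act A ξ) η = inner ℂ ξ (act A η) := by
  have h : IsSelfAdjoint (Matrix.toEuclideanCLM (𝕜 := ℂ) A) := hA.map _
  exact (ContinuousLinearMap.isSelfAdjoint_iff_isSymmetric.1 h) ξ η

theorem isSelfAdjoint_sqrtAbsRe (A : Matrix (Fin 2) (Fin 2) ℂ) : IsSelfAdjoint (sqrtAbsRe A) :=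
  cfc_predicate _ _

/-- On the spectrum `(|t|^{1/2})⁴ = t²`. At the fourth power the sign of `t` disappears, so positive
and negative definite matrices are treated alike. -/
theorem sqrtAbsRe_pow_four (A : Matrix (Fin 2) (Fin 2) ℂ) :
    (sqrtAbsRe A * sqrtAbsRe A) * (sqrtAbsRe A * sqrtAbsRe A) = reM A * reM A := by
  have hsa := isSelfAdjoint_reM A
  have hc : Continuous fun t : ℝ => √|t| := by fun_prop
  have h1 : sqrtAbsRe A * sqrtAbsRe A = cfc (fun t : ℝ => |t|) (reM A) := by
    rw [sqrtAbsRe, ← cfc_mul _ _ _ hc.continuousOn hc.continuousOn]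
    exact cfc_congr fun t _ => Real.mul_self_sqrt (abs_nonneg t)
  have hc2 : Continuous fun t : ℝ => |t| := by fun_prop
  rw [h1, ← cfc_mul _ _ _ hc2.continuousOn hc2.continuousOn]
  conv_rhs => rw [← cfc_id' ℝ (reM A),
    ← cfc_mul (fun t : ℝ => t) (fun t : ℝ => t) _ (by fun_prop) (by fun_prop)]
  exact cfc_congr fun t _ => abs_mul_abs_self t

theorem isUnit_det_sqrtAbsRe {A : Matrix (Fin 2) (Fin 2) ℂ} (hA : IsUnit (reM A).det) :
    IsUnit (sqrtAbsRe A).det := by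
  have h := congrArg Matrix.det (sqrtAbsRe_pow_four A)
  simp only [Matrix.det_mul] at h
  rw [isUnit_iff_ne_zero] at hA ⊢
  intro h0
  rw [h0] at h
  simp [hA] at h

/-- `Re A` and `|Re A|` are self-adjoint with the same square, hence give vectors of the same
length. -/
theorem norm_act_reM (A : Matrix (Fin 2) (Fin 2) ℂ) (ξ : C2) :
    ‖act (reM A) ξ‖ = ‖act (sqrtAbsRe A) (act (sqrtAbsRe A) ξ)‖ := by
  have hsa := isSelfAdjoint_reM A
  have hs := isSelfAdjoint_sqrtAbsRe A
  have h : (inner ℂ (act (reM A) ξ) (act (reM A) ξ) : ℂ) =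
      inner ℂ (act (sqrtAbsRe A) (act (sqrtAbsRe A) ξ))
        (act (sqrtAbsRe A) (act (sqrtAbsRe A) ξ)) := by
    rw [inner_act_left hsa, inner_act_left hs, inner_act_left hs, ← act_mul, ← act_mul, ← act_mul,
      ← act_mul, ← sqrtAbsRe_pow_four]
    simp only [mul_assoc]
  rw [inner_self_eq_norm_sq_to_K, inner_self_eq_norm_sq_to_K] at h
  have h2 : ‖act (reM A) ξ‖ ^ 2 = ‖act (sqrtAbsRe A) (act (sqrtAbsRe A) ξ)‖ ^ 2 := by
    exact_mod_cast h
  exact (sq_eq_sq₀ (norm_nonneg _) (norm_nonneg _)).1 h2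

theorem reM_add_imM (A : Matrix (Fin 2) (Fin 2) ℂ) : reM A + Complex.I • imM A = A := by
  ext i j
  simp only [reM, imM, Matrix.add_apply, Matrix.smul_apply, Matrix.sub_apply, smul_eq_mul]
  field_simp [Complex.I_ne_zero]
  ring

section
open scoped ComplexOrder

theorem Contrast.isUnit_det {D : Set (ℝ × ℝ)} (Q : Contrast D) :
    ∀ᵐ x ∂(volume.restrict D), IsUnit (sqrtAbsRe (Q.toFun x)).det := by
  filter_upwards [Q.definite] with x hx
  refine isUnit_det_sqrtAbsRe ?_
  rw [← Matrix.isUnit_iff_isUnit_det]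
  rcases hx with h | h
  · exact h.isUnit
  · exact (IsUnit.neg_iff _).1 h.isUnit

end

/-! ### Gradients in the completion and the two solution concepts -/

theorem weightMapQ_toH1Q {D : Set (ℝ × ℝ)} {α : ℝ} (Q : Contrast D) (u : H1 D α) :
    weightMapQ α Q (u.toH1Q Q) = weightMap α Q u :=
  ContinuousLinearMap.fromCompletion_apply_coe _ _

/-- Definiteness of `Re Q` enters here: `|Re Q|^{1/2}` is invertible almost everywhere, so the
weight in the isometry can be undone. Both directions of the equivalence rest on this. -/
theorem gradQ_toH1Q {D : Set (ℝ × ℝ)} {α : ℝ} (Q : Contrast D) (u : H1 D α) :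
    ∀ᵐ x ∂(volume.restrict D), gradQ (u.toH1Q Q) x = u.grad x := by
  filter_upwards [Q.isUnit_det, (Q.memLp u.grad).coeFn_toLp] with x h1 h2
  rw [gradQ, weightMapQ_toH1Q]
  change act _ ((Q.memLp u.grad).toLp _ x) = _
  rw [h2, ← act_mul, Matrix.nonsing_inv_mul _ h1, act_one]

theorem SolvesH1.toH1Q {D : Set (ℝ × ℝ)} {α k : ℝ} {Q : Contrast D} {f : L2v D} {u : H1 D α}
    (h : SolvesH1 k Q f u) : SolvesH1Q k Q f (u.toH1Q Q) := by
  obtain ⟨g, hg, hu⟩ := h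
  refine ⟨g, ?_, u, hu, rfl⟩
  filter_upwards [hg, gradQ_toH1Q Q u] with x h1 h2
  rw [h1, h2]

/-- The preimage is `w = L_k(Q∇v + f)` itself: as `v` is its image, `∇v = ∇w` almost everywhere and
the density equals `Q∇w + f`. -/
theorem SolvesH1Q.exists_solvesH1 {D : Set (ℝ × ℝ)} {α k : ℝ} {Q : Contrast D} {f : L2v D}
    {v : H1Q α Q} (h : SolvesH1Q k Q f v) : ∃ u : H1 D α, u.toH1Q Q = v ∧ SolvesH1 k Q f u := by
  obtain ⟨g, hg, w, hw, rfl⟩ := h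
  refine ⟨w, rfl, g, ?_, hw⟩
  filter_upwards [hg, gradQ_toH1Q Q w] with x h1 h2
  rw [h1, h2]

theorem aestronglyMeasurable_gradQ {D : Set (ℝ × ℝ)} {α : ℝ} {Q : Contrast D} (v : H1Q α Q) :
    AEStronglyMeasurable (gradQ v) (volume.restrict D) := by
  refine aestronglyMeasurable_act ?_ (Lp.aestronglyMeasurable (weightMapQ α Q v).snd)
  have hS := Q.aestronglyMeasurable_sqrt
  have hd : AEStronglyMeasurable (fun x => (sqrtAbsRe (Q.toFun x)).det) (volume.restrict D) :=
    Continuous.comp_aestronglyMeasurable (g := fun A : Matrix (Fin 2) (Fin 2) ℂ => A.det)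
      (by fun_prop) hS
  have ha : AEStronglyMeasurable (fun x => (sqrtAbsRe (Q.toFun x)).adjugate)
      (volume.restrict D) :=
    Continuous.comp_aestronglyMeasurable (g := fun A : Matrix (Fin 2) (Fin 2) ℂ => A.adjugate)
      (by fun_prop) hS
  -- Inversion is not continuous on all matrices, but the determinant and the adjugate are, and the
  -- scalar inverse is measurable.
  simp only [Matrix.inv_def, Ring.inverse_eq_inv']
  exact hd.aemeasurable.inv.aestronglyMeasurable.smul ha

/-- With `p = |Re Q|^{1/2}∇v` in `L²`, the length of `Re Q ∇v` is that of `|Re Q|^{1/2} p`, where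
the matrix is bounded. The inverse weight, which may be unbounded, never has to be estimated. -/
theorem memLp_act_gradQ {D : Set (ℝ × ℝ)} {α : ℝ} {Q : Contrast D} {C : ℝ}
    (h : ∀ᵐ x ∂(volume.restrict D), ∀ ξ : C2,
      ‖act (imM (Q.toFun x)) ξ‖ ≤ C * ‖act (reM (Q.toFun x)) ξ‖) (v : H1Q α Q) :
    MemLp (fun x => act (Q.toFun x) (gradQ v x)) 2 (volume.restrict D) := by
  set p : L2v D := (weightMapQ α Q v).snd with hp
  refine MemLp.of_le_mul (c := 1 + C) (Q.memLp p)
    (aestronglyMeasurable_act Q.aestronglyMeasurable (aestronglyMeasurable_gradQ v)) ?_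
  filter_upwards [h, Q.isUnit_det] with x h1 h2
  have e : act (sqrtAbsRe (Q.toFun x)) (gradQ v x) = p x := by
    rw [gradQ, ← act_mul, Matrix.mul_nonsing_inv _ h2, act_one]
  have e2 : act (Q.toFun x) (gradQ v x) = act (reM (Q.toFun x)) (gradQ v x) +
      Complex.I • act (imM (Q.toFun x)) (gradQ v x) := by
    conv_lhs => rw [← reM_add_imM (Q.toFun x)]
    simp [act]
  calc _ ≤ ‖act (reM (Q.toFun x)) (gradQ v x)‖ + ‖act (imM (Q.toFun x)) (gradQ v x)‖ := by
        rw [e2]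
        refine (norm_add_le _ _).trans_eq ?_
        rw [norm_smul, Complex.norm_I, one_mul]
    _ ≤ (1 + C) * ‖act (reM (Q.toFun x)) (gradQ v x)‖ := by linarith [h1 (gradQ v x)]
    _ = _ := by rw [norm_act_reM, e]

end Grating

end

theorem mainTheorem9 (k α ρ : ℝ) (hk : 0 < k)
    (hres : ∀ j : ℤ, k ^ 2 ≠ Grating.alphaJ α j ^ 2)
    (D : Set (ℝ × ℝ)) (hD : IsOpen D)
    (hDρ : D ⊆ Set.Ioo (-Real.pi) Real.pi ×ˢ Set.Ioo (-ρ) ρ)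
    (Q : Grating.Contrast D) (f : Grating.L2v D) :
    -- the operator `L_k` from `L²(D, ℂ²)` to `H¹_α(D)` is well defined
    (∀ g : Grating.L2v D, ∃! w : Grating.H1 D α, Grating.IsLk k α D g w) ∧
    -- solutions in `H¹_α(D)` are solutions in `H¹_{α,Q}(D)`
    (∀ u : Grating.H1 D α, Grating.SolvesH1 k Q f u → Grating.SolvesH1Q k Q f (u.toH1Q Q)) ∧
    -- solutions in `H¹_{α,Q}(D)` belong to `H¹_α(D)` and are solutions there
    (∀ v : Grating.H1Q α Q, Grating.SolvesH1Q k Q f v →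
      ∃ u : Grating.H1 D α, u.toH1Q Q = v ∧ Grating.SolvesH1 k Q f u) ∧
    -- if `|Im Q ξ| ≤ C |Re Q ξ|`, then `Q∇v` is in `L²(D, ℂ²)` for every `v` in `H¹_{α,Q}(D)`
    ((∃ C : ℝ, 0 < C ∧ ∀ᵐ x ∂(MeasureTheory.volume.restrict D), ∀ ξ : Grating.C2,
        ‖Grating.act (Grating.imM (Q.toFun x)) ξ‖ ≤
          C * ‖Grating.act (Grating.reM (Q.toFun x)) ξ‖) →
      ∀ v : Grating.H1Q α Q, MeasureTheory.MemLp
        (fun x => Grating.act (Q.toFun x) (Grating.gradQ v x)) 2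
        (MeasureTheory.volume.restrict D)) := by
  refine ⟨fun g => ?_, fun u hu => hu.toH1Q, fun v hv => hv.exists_solvesH1, ?_⟩
  · obtain ⟨w, hw⟩ := Grating.exists_isLk hk hres hD hDρ g
    exact ⟨w, hw, fun w' hw' => hw'.unique hD
      ((MeasureTheory.measure_mono hDρ).trans_lt (Grating.volume_box_lt_top ρ)) hw⟩
  · rintro ⟨C, -, h⟩ v
    exact Grating.memLp_act_gradQ h v
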